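/- Let $\mathcal B$ be the category of sets with $\boxtimes=\times$, or the category of modules over a field $K$ with $\boxtimes=\otimes_K$, and let $s\mathcal B$ be the category of simplicial objects in $\mathcal B$. For a set $S$ and $X\in\mathcal B$ write $S\otimes X=\coprod_S X$; all constructions are applied to simplicial objects level by level. Let $\mathcal C$ be an operad in simplicial sets (with unit and symmetric group actions) with $\mathcal C(0)=*$, the one-point simplicial set, and let $R\in s\mathcal B$ be a $\mathcal C$-algebra. Let $C X=\coprod_{n\ge 0}\mathcal C(n)\otimes_{\Sigma_n}X^{\boxtimes n}$ be the monad of $\mathcal C$ and, for $n\geq 0$, let $$D_nX=\coprod_{\ell\ge 0}\mathcal C(n+\ell)\otimes_{\Sigma_\ell}X^{\boxtimes \ell},$$ where $\Sigma_\ell$ permutes the last $\ell$ inputs. Let $A(n)=D_n\otimes_C R$ be the coequalizer of the two maps $D_nCR\rightrightarrows D_nR$ given by operad composition in the last $\ell$ inputs, $D_nC\to D_n$, and by the algebra structure $CR\to R$. An object of $s\mathcal B$ fibered over a simplicial set $S$ is a functor $x\mapsto F_x$ to $\mathcal B$ from the category whose objects are the simplices of $S$ and whose morphisms $s\to t$ are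 the simplicial operators $\varphi$ with $\varphi(s)=t$. Its total object $h_\sharp F\in s\mathcal B$ is $\coprod_{x\in S_i}F_x$ in simplicial degree $i$. An operad $Q$ in $s\mathcal B$ fibered over $\mathcal C$ consists of objects $Q(n)$ of $s\mathcal B$ fibered over $\mathcal C(n)$, a unit over the unit of $\mathcal C$, actions of $\Sigma_n$ over those on $\mathcal C(n)$, and compositions $$Q(k)_x\boxtimes Q(n_1)_{y_1}\boxtimes\cdots\boxtimes Q(n_k)_{y_k}\to Q(n_1+\cdots+n_k)_{\gamma(x;y_1,\dots,y_k)},$$ natural in the simplicial direction and satisfying the analogues of the operad axioms (associativity, unit, equivariance). Then the objects $A(n)$ have a natural structure of an operad in $s\mathcal B$ fibered over $\mathcal C$. Precisely: (1) There are an operad $A$ in $s\mathcal B$ fibered over $\mathcal C$ and identifications $h_\sharp A(n)\cong D_n\otimes_C R$ such that the following hold, where $[y;r]$ is the class of $y\otimes r$ with $y\in\mathcal C(n+\ell)_i$ and $r\in R_i^{\ell}$: (a) $[y;r]$ lies in the fibre $A(n)_x$ over $x=\gamma(y;1,\dots,1,*,\dots,*)$ ($n$ units, $\ell$ points); (b)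 the unit is $[1;\ ]$ with $1\in\mathcal C(1)$; (c) $\sigma\in\Sigma_n$ acts by $[y;r]\sigma=[y(\sigma\oplus 1_\ell);r]$; (d) the composition of $[y;r]$, where $y\in\mathcal C(k+\ell)_i$ and $r\in R_i^\ell$, with $[y_j;r_j]$, where $y_j\in\mathcal C(n_j+p_j)_i$ and $r_j\in R_i^{p_j}$, for $j=1,\dots,k$, is $[w;(r,r_1,\dots,r_k)]$, where $w$ is $\gamma(y;y_1,\dots,y_k,1,\dots,1)$ with its inputs reordered: first the first $n_j$ inputs of each $y_j$, $j=1,\dots,k$; then the last $\ell$ inputs of $y$; then the last $p_j$ inputs of each $y_j$, $j=1,\dots,k$. (2) For a morphism of $\mathcal C$-algebras $f:R\to R'$ and structures $A$ for $R$ and $A'$ for $R'$ as in (1), there is a unique morphism $A\to A'$ of operads fibered over $\mathcal C$ whose total maps are $D_n\otimes_C f:D_n\otimes_C R\to D_n\otimes_C R'$. In particular the structure in (1) is unique up to unique isomorphism. -/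

import Mathlib

open CategoryTheory CategoryTheory.Limits Equiv
open scoped TensorProduct DirectSum

universe u

noncomputable section

/-! ### Arities -/

/-- The set of all input slots of a family of operations of arities `n j`. -/
abbrev Slots {J : Type} (n : J → ℕ) : Type := Σ j, Fin (n j)

/-- The slots of operations of arities `n 0, …, n (k-1)`, listed one block after the other. -/
def blocks {k m : ℕ} {n : Fin k → ℕ} (h : ∑ j, n j = m) : Slots n ≃ Fin m :=
  finSigmaFinEquiv.trans (finCongr h)

def slotsSum {J L : Type} (s : J → ℕ) (t : L → ℕ) :
    Slots (Sum.elim s t) ≃ Slots s ⊕ Slots t :=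
  Equiv.sumSigmaDistrib fun b => Fin (Sum.elim s t b)

def slotsAdd {J : Type} (s t : J → ℕ) : Slots (fun j => s j + t j) ≃ Slots s ⊕ Slots t :=
  (Equiv.sigmaCongrRight fun _ => finSumFinEquiv.symm).trans
    (Equiv.sigmaSumDistrib (fun j => Fin (s j)) (fun j => Fin (t j)))

def slotsOne (J : Type) : Slots (fun _ : J => 1) ≃ J := Equiv.sigmaUnique J fun _ => Fin 1

def slotsZero (J : Type) : Slots (fun _ : J => 0) ≃ Empty where
  toFun s := s.2.elim0
  invFun s := s.elim
  left_inv s := s.2.elim0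
  right_inv s := s.elim

theorem Slots.sum_eq {J : Type} {k m : ℕ} {n : J → ℕ} (a : J ≃ Fin k) (e : Slots n ≃ Fin m) :
    ∑ i, n (a.symm i) = m :=
  Fin.equiv_iff_eq.1
    ⟨finSigmaFinEquiv.symm.trans
      ((Equiv.sigmaCongrLeft (β := fun j => Fin (n j)) a.symm).trans e)⟩

/-- The block permutation `σ(n₁, …, n_k)`: it carries the `i`-th block, of size `n i`, to the
`σ i`-th block of the list of sizes `n (σ⁻¹ 1), …, n (σ⁻¹ k)`. -/
def blockPerm {k m : ℕ} {n : Fin k → ℕ} (σ : Perm (Fin k)) (h : ∑ j, n j = m)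
    (h' : ∑ j, n (σ.symm j) = m) : Perm (Fin m) :=
  (blocks h).symm.trans
    ((Equiv.sigmaCongrLeft (β := fun j => Fin (n j)) σ.symm).symm.trans (blocks h'))

/-- The permutation `σ ⊕ τ` of `n + l` letters. -/
def sumPerm {n l : ℕ} (σ : Perm (Fin n)) (τ : Perm (Fin l)) : Perm (Fin (n + l)) :=
  finSumFinEquiv.permCongr (Equiv.sumCongr σ τ)

/-- Concatenation of words. -/
def concat {k : ℕ} {n : Fin k → ℕ} {X : Type u} (r : ∀ j, Fin (n j) → X) : Fin (∑ j, n j) → X :=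
  fun p => r (finSigmaFinEquiv.symm p).1 (finSigmaFinEquiv.symm p).2

/-! ### Operads of sets -/

/-- The operations of an operad: a unit, right actions of the symmetric groups, and compositions
`γ : P k × P n₁ × ⋯ × P n_k → P m`, where `m = n₁ + ⋯ + n_k`. -/
structure OperadData (P : ℕ → Type u) where
  one : P 1
  act : ∀ {n : ℕ}, P n → Perm (Fin n) → P n
  comp : ∀ {k m : ℕ} {n : Fin k → ℕ}, ∑ j, n j = m → P k → (∀ j, P (n j)) → P m

/-- The axioms of an operad. -/
structure OperadData.IsOperad {P : ℕ → Type u} (C : OperadData P) : Prop where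
  act_one : ∀ {n : ℕ} (x : P n), C.act x 1 = x
  act_mul : ∀ {n : ℕ} (x : P n) (σ τ : Perm (Fin n)), C.act x (σ * τ) = C.act (C.act x σ) τ
  one_comp : ∀ {n : ℕ} (h : ∑ _j : Fin 1, n = n) (x : P n), C.comp h C.one (fun _ => x) = x
  comp_one : ∀ {n : ℕ} (h : ∑ _j : Fin n, 1 = n) (x : P n), C.comp h x (fun _ => C.one) = x
  assoc : ∀ {k m N : ℕ} {n : Fin k → ℕ} {p : ∀ j, Fin (n j) → ℕ} (h : ∑ j, n j = m)
    (h₁ : ∑ i : Fin m, p ((blocks h).symm i).1 ((blocks h).symm i).2 = N)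
    (h₂ : ∑ j, ∑ l, p j l = N) (x : P k) (y : ∀ j, P (n j)) (z : ∀ j l, P (p j l)),
    C.comp h₁ (C.comp h x y) (fun i => z ((blocks h).symm i).1 ((blocks h).symm i).2) =
      C.comp h₂ x (fun j => C.comp rfl (y j) (z j))
  act_comp : ∀ {k m : ℕ} {n : Fin k → ℕ} (h : ∑ j, n j = m) (σ : Perm (Fin k))
    (h' : ∑ j, n (σ.symm j) = m) (x : P k) (y : ∀ j, P (n j)),
    C.comp h (C.act x σ) y =
      C.act (C.comp h' x (fun j => y (σ.symm j))) (blockPerm σ h h')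
  comp_act : ∀ {k m : ℕ} {n : Fin k → ℕ} (h : ∑ j, n j = m) (x : P k) (y : ∀ j, P (n j))
    (τ : ∀ j, Perm (Fin (n j))),
    C.comp h x (fun j => C.act (y j) (τ j)) =
      C.act (C.comp h x y) ((blocks h).permCongr (Equiv.sigmaCongrRight τ))

/-- Operad composition with relabelled inputs: the inputs of `x` are labelled by `J` through `a`,
an operation `y j` is inserted at the input `j`, and the `l`-th input of `y j` becomes the input
number `e ⟨j, l⟩` of the result. -/
def OperadData.compAt {P : ℕ → Type u} (C : OperadData P) {J : Type} {k m : ℕ} {n : J → ℕ}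
    (a : J ≃ Fin k) (e : Slots n ≃ Fin m) (x : P k) (y : ∀ j, P (n j)) : P m :=
  C.act (C.comp (Slots.sum_eq a e) x (fun i => y (a.symm i)))
    ((blocks (Slots.sum_eq a e)).symm.trans
      ((Equiv.sigmaCongrLeft (β := fun j => Fin (n j)) a.symm).trans e)).symm

/-- `γ(y; 1, …, 1, z₁, …, z_l)` with `n` units. -/
def OperadData.graft {P : ℕ → Type u} (C : OperadData P) (n : ℕ) {l : ℕ} {m : Fin l → ℕ}
    (y : P (n + l)) (z : ∀ j, P (m j)) : P (n + ∑ j, m j) :=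
  C.compAt (n := Sum.elim (fun _ : Fin n => 1) m) finSumFinEquiv
    ((slotsSum _ _).trans
      ((Equiv.sumCongr (slotsOne (Fin n)) finSigmaFinEquiv).trans finSumFinEquiv))
    y (Sum.rec (fun _ => C.one) z)

/-- `γ(y; 1, …, 1, pt, …, pt)` with `n` units, for `pt` an operation without inputs. -/
def OperadData.cap {P : ℕ → Type u} (C : OperadData P) (pt : P 0) (n : ℕ) {l : ℕ}
    (y : P (n + l)) : P n :=
  C.compAt (n := Sum.elim (fun _ : Fin n => 1) (fun _ : Fin l => 0)) finSumFinEquiv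
    ((slotsSum _ _).trans
      ((Equiv.sumCongr (slotsOne (Fin n)) (slotsZero (Fin l))).trans (Equiv.sumEmpty _ _)))
    y (Sum.rec (fun _ => C.one) (fun _ => pt))

/-- `γ(y; y₁, …, y_k, 1, …, 1)` with `l` units, where the inputs of the result are reordered as
follows: the first `n j` inputs of `y j` for `j = 1, …, k`, then the last `l` inputs of `y`, then
the last `p j` inputs of `y j` for `j = 1, …, k`. -/
def OperadData.compSplit {P : ℕ → Type u} (C : OperadData P) {k l m : ℕ} {n p : Fin k → ℕ}
    (h : ∑ j, n j = m) (y : P (k + l)) (z : ∀ j, P (n j + p j)) : P (m + (l + ∑ j, p j)) :=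
  C.compAt (n := Sum.elim (fun j => n j + p j) (fun _ : Fin l => 1)) finSumFinEquiv
    ((slotsSum _ _).trans <|
      (Equiv.sumCongr (slotsAdd n p) (slotsOne (Fin l))).trans <|
      (Equiv.sumAssoc _ _ _).trans <|
      (Equiv.sumCongr (blocks h)
        ((Equiv.sumComm _ _).trans
          ((Equiv.sumCongr (Equiv.refl _) finSigmaFinEquiv).trans finSumFinEquiv))).trans
      finSumFinEquiv)
    y (Sum.rec z (fun _ => C.one))

/-! ### Operads of simplicial sets -/

/-- An operad in simplicial sets. -/
structure SimplicialOperad where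
  obj : ℕ → SSet.{u}
  data : ∀ d, OperadData fun n => (obj n).obj d
  isOperad : ∀ d, (data d).IsOperad
  map_one : ∀ {d d' : SimplexCategoryᵒᵖ} (φ : d ⟶ d'), (obj 1).map φ (data d).one = (data d').one
  map_act : ∀ {d d' : SimplexCategoryᵒᵖ} (φ : d ⟶ d') {n : ℕ} (x : (obj n).obj d)
    (σ : Perm (Fin n)),
    (obj n).map φ ((data d).act x σ) = (data d').act ((obj n).map φ x) σ
  map_comp : ∀ {d d' : SimplexCategoryᵒᵖ} (φ : d ⟶ d') {k m : ℕ} {n : Fin k → ℕ}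
    (h : ∑ j, n j = m) (x : (obj k).obj d) (y : ∀ j, (obj (n j)).obj d),
    (obj m).map φ ((data d).comp h x y) =
      (data d').comp h ((obj k).map φ x) (fun j => (obj (n j)).map φ (y j))

theorem SimplicialOperad.map_compAt (C : SimplicialOperad.{u}) {d d' : SimplexCategoryᵒᵖ}
    (φ : d ⟶ d') {J : Type} {k m : ℕ} {n : J → ℕ} (a : J ≃ Fin k) (e : Slots n ≃ Fin m)
    (x : (C.obj k).obj d) (y : ∀ j, (C.obj (n j)).obj d) :
    (C.obj m).map φ ((C.data d).compAt a e x y) =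
      (C.data d').compAt a e ((C.obj k).map φ x) (fun j => (C.obj (n j)).map φ (y j)) := by
  simp only [OperadData.compAt, C.map_act, C.map_comp]

theorem SimplicialOperad.map_graft (C : SimplicialOperad.{u}) {d d' : SimplexCategoryᵒᵖ}
    (φ : d ⟶ d') (n : ℕ) {l : ℕ} {m : Fin l → ℕ} (y : (C.obj (n + l)).obj d)
    (z : ∀ j, (C.obj (m j)).obj d) :
    (C.obj (n + ∑ j, m j)).map φ ((C.data d).graft n y z) =
      (C.data d').graft n ((C.obj (n + l)).map φ y) (fun j => (C.obj (m j)).map φ (z j)) := by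
  rw [OperadData.graft, C.map_compAt, OperadData.graft]
  congr 1
  funext j
  rcases j with j | j
  · exact C.map_one φ
  · rfl

/-! ### The ground category

The ground category is the category of sets, or of modules over a field. The following class
only records, so that the two cases can be treated at once, what is a map out of a tensor product
(in terms of elements), and how coproducts of tensor powers and quotients are formed. It is used
only for the two instances below. -/

/-- Tensor powers, their coproducts, and quotients in a concrete category. -/
class TensorBase (B : Type (u + 1)) [Category.{u} B] {FB : outParam (B → B → Type u)}
    {CB : outParam (B → Type u)} [outParam (∀ X Y, FunLike (FB X Y) (CB X) (CB Y))]
    [ConcreteCategory B FB] where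
  /-- The functions of elements that are the same as morphisms from `⊠ i, X i` to `Y`. -/
  IsMulti {ι : Type} (X : ι → B) (Y : B) : ((∀ i, ToType (X i)) → ToType Y) → Prop
  postcomp {ι : Type} {X : ι → B} {Y Z : B} {f : (∀ i, ToType (X i)) → ToType Y}
    (hf : IsMulti X Y f) (g : Y ⟶ Z) : IsMulti X Z fun v => g (f v)
  precomp {ι : Type} {X X' : ι → B} {Y : B} {f : (∀ i, ToType (X i)) → ToType Y}
    (hf : IsMulti X Y f) (g : ∀ i, X' i ⟶ X i) : IsMulti X' Y fun v => f fun i => g i (v i)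
  /-- `∐ t, X ^ ⊠ (a t)` -/
  powers {T : Type u} (a : T → ℕ) (X : B) : B
  /-- The class of the word `r` in the summand with index `t`. -/
  word {T : Type u} (a : T → ℕ) (X : B) (t : T) (r : Fin (a t) → ToType X) : ToType (powers a X)
  word_isMulti {T : Type u} (a : T → ℕ) (X : B) (t : T) :
    IsMulti (fun _ : Fin (a t) => X) (powers a X) (word a X t)
  powersDesc {T : Type u} {a : T → ℕ} {X Y : B} (f : ∀ t, (Fin (a t) → ToType X) → ToType Y)
    (hf : ∀ t, IsMulti (fun _ : Fin (a t) => X) Y (f t)) : powers a X ⟶ Y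
  powersDesc_word {T : Type u} {a : T → ℕ} {X Y : B} (f : ∀ t, (Fin (a t) → ToType X) → ToType Y)
    (hf : ∀ t, IsMulti (fun _ : Fin (a t) => X) Y (f t)) (t : T) (r : Fin (a t) → ToType X) :
    powersDesc f hf (word a X t r) = f t r
  powers_ext {T : Type u} {a : T → ℕ} {X Y : B} {f g : powers a X ⟶ Y}
    (h : ∀ t r, f (word a X t r) = g (word a X t r)) : f = g
  /-- The quotient of `Y` by the relation generated by `ρ`. -/
  quot (Y : B) (ρ : ToType Y → ToType Y → Prop) : B
  proj (Y : B) (ρ : ToType Y → ToType Y → Prop) : Y ⟶ quot Y ρ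
  proj_eq {Y : B} {ρ : ToType Y → ToType Y → Prop} {v w : ToType Y} (h : ρ v w) :
    proj Y ρ v = proj Y ρ w
  quotDesc {Y Z : B} {ρ : ToType Y → ToType Y → Prop} (f : Y ⟶ Z)
    (hf : ∀ v w, ρ v w → f v = f w) : quot Y ρ ⟶ Z
  quotDesc_proj {Y Z : B} {ρ : ToType Y → ToType Y → Prop} (f : Y ⟶ Z)
    (hf : ∀ v w, ρ v w → f v = f w) (v : ToType Y) : quotDesc f hf (proj Y ρ v) = f v
  quot_ext {Y Z : B} {ρ : ToType Y → ToType Y → Prop} {f g : quot Y ρ ⟶ Z}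
    (h : ∀ v, f (proj Y ρ v) = g (proj Y ρ v)) : f = g

/-- Sets: the product is the Cartesian product. -/
instance TensorBase.sets : TensorBase.{u} (Type u) where
  IsMulti _ _ _ := True
  postcomp _ _ := trivial
  precomp _ _ := trivial
  powers {T} a X := Σ t : T, Fin (a t) → X
  word _ _ t r := ⟨t, r⟩
  word_isMulti _ _ _ := trivial
  powersDesc f _ := TypeCat.ofHom fun v => f v.1 v.2
  powersDesc_word _ _ _ _ := rfl
  powers_ext h := by
    ext ⟨t, r⟩
    exact h t r
  quot _ ρ := Quot ρ
  proj _ ρ := TypeCat.ofHom (Quot.mk ρ)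
  proj_eq h := Quot.sound h
  quotDesc f hf := TypeCat.ofHom (Quot.lift f hf)
  quotDesc_proj _ _ _ := rfl
  quot_ext h := by
    ext v
    induction v using Quot.ind with
    | _ v => exact h v

open Classical in
/-- Modules: the product is the tensor product over `K`. -/
instance TensorBase.modules (K : Type u) [Field K] : TensorBase.{u} (ModuleCat.{u} K) where
  IsMulti {ι} X Y f := ∃ g : MultilinearMap K (fun i : ι => X i) Y, ∀ v, g v = f v
  postcomp := by
    rintro ι X Y Z f ⟨g, hg⟩ φ
    exact ⟨φ.hom.compMultilinearMap g, fun v => by simp [← hg]⟩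
  precomp := by
    rintro ι X X' Y f ⟨g, hg⟩ φ
    exact ⟨g.compLinearMap fun i => (φ i).hom, fun v => by simp [← hg]⟩
  powers {T} a X := ModuleCat.of K (⨁ t : T, ⨂[K] _i : Fin (a t), X)
  word {T} a X t r :=
    DirectSum.lof K T (fun t => ⨂[K] _i : Fin (a t), X) t (PiTensorProduct.tprod K r)
  word_isMulti {T} a X t :=
    ⟨(DirectSum.lof K T (fun t => ⨂[K] _i : Fin (a t), X) t).compMultilinearMap
      (PiTensorProduct.tprod K), fun _ => rfl⟩
  powersDesc {T} a X Y f hf := ModuleCat.ofHom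
    (DirectSum.toModule K T Y fun t => PiTensorProduct.lift (hf t).choose)
  powersDesc_word {T} a X Y f hf t r := by
    simp [(hf t).choose_spec]
  powers_ext {T} a X Y f g h := by
    ext : 1
    refine DirectSum.linearMap_ext K fun t => PiTensorProduct.ext ?_
    ext r
    exact h t r
  quot Y ρ := ModuleCat.of K (Y ⧸ Submodule.span K {v : Y | ∃ a b, ρ a b ∧ v = a - b})
  proj Y ρ := ModuleCat.ofHom (Submodule.mkQ _)
  proj_eq {Y ρ v w} h := (Submodule.Quotient.eq _).2 (Submodule.subset_span ⟨v, w, h, rfl⟩)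
  quotDesc {Y Z ρ} f hf := ModuleCat.ofHom (Submodule.liftQ _ f.hom (by
    rw [Submodule.span_le]
    rintro _ ⟨a, b, hab, rfl⟩
    simp [hf a b hab]))
  quotDesc_proj _ _ _ := rfl
  quot_ext {Y Z ρ f g} h := by
    ext : 1
    refine Submodule.linearMap_qext _ ?_
    ext v
    exact h v

section

variable (C : SimplicialOperad.{u}) (B : Type (u + 1)) [Category.{u} B] {FB : B → B → Type u}
  {CB : B → Type u} [∀ X Y, FunLike (FB X Y) (CB X) (CB Y)] [ConcreteCategory B FB]
  [TensorBase B]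

/-! ### Algebras -/

/-- An algebra over `C` in simplicial objects of `B`: structure maps `C(n) ⊗ R ^ ⊠ n ⟶ R`
on each simplicial level, natural in the simplicial direction. -/
structure OperadAlgebra where
  obj : SimplicialObject B
  act : ∀ {d : SimplexCategoryᵒᵖ} {n : ℕ}, (C.obj n).obj d →
    (Fin n → ToType (obj.obj d)) → ToType (obj.obj d)
  act_isMulti : ∀ {d : SimplexCategoryᵒᵖ} {n : ℕ} (x : (C.obj n).obj d),
    TensorBase.IsMulti (fun _ : Fin n => obj.obj d) (obj.obj d) (act x)
  map_act : ∀ {d d' : SimplexCategoryᵒᵖ} (φ : d ⟶ d') {n : ℕ} (x : (C.obj n).obj d)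
    (r : Fin n → ToType (obj.obj d)),
    obj.map φ (act x r) = act ((C.obj n).map φ x) (fun i => obj.map φ (r i))
  one_act : ∀ {d : SimplexCategoryᵒᵖ} (r : Fin 1 → ToType (obj.obj d)),
    act (C.data d).one r = r 0
  act_act : ∀ {d : SimplexCategoryᵒᵖ} {n : ℕ} (x : (C.obj n).obj d) (σ : Perm (Fin n))
    (r : Fin n → ToType (obj.obj d)), act ((C.data d).act x σ) r = act x (r ∘ σ.symm)
  comp_act : ∀ {d : SimplexCategoryᵒᵖ} {k m : ℕ} {n : Fin k → ℕ} (h : ∑ j, n j = m)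
    (x : (C.obj k).obj d) (y : ∀ j, (C.obj (n j)).obj d) (r : Fin m → ToType (obj.obj d)),
    act ((C.data d).comp h x y) r = act x (fun j => act (y j) (fun l => r (blocks h ⟨j, l⟩)))

variable {C B}

/-- A morphism of `C`-algebras. -/
structure OperadAlgebra.Hom (R R' : OperadAlgebra C B) where
  app : R.obj ⟶ R'.obj
  map_act : ∀ {d : SimplexCategoryᵒᵖ} {n : ℕ} (x : (C.obj n).obj d)
    (r : Fin n → ToType (R.obj.obj d)),
    app.app d (R.act x r) = R'.act x (fun i => app.app d (r i))

/-! ### The functors `D_n` -/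

namespace DFunctor

variable (C) in
/-- `∐ l, C(n + l) ⊗ X ^ ⊠ l` on the simplicial level `d`. -/
abbrev pre (n : ℕ) (d : SimplexCategoryᵒᵖ) (X : B) : B :=
  TensorBase.powers (T := Σ l, (C.obj (n + l)).obj d) Sigma.fst X

variable (C) in
/-- The word `y ⊗ r`. -/
def preWord {n : ℕ} {d : SimplexCategoryᵒᵖ} {X : B} {l : ℕ} (y : (C.obj (n + l)).obj d)
    (r : Fin l → ToType X) : ToType (pre C n d X) :=
  TensorBase.word (T := Σ l, (C.obj (n + l)).obj d) Sigma.fst X ⟨l, y⟩ r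

variable (C) in
/-- The relation `y σ ⊗ r ∼ y ⊗ σ r`, where `σ` permutes the last `l` inputs of `y`. -/
inductive OrbitRel (n : ℕ) (d : SimplexCategoryᵒᵖ) (X : B) :
    ToType (pre C n d X) → ToType (pre C n d X) → Prop
  | intro {l : ℕ} (y : (C.obj (n + l)).obj d) (σ : Perm (Fin l)) (r : Fin l → ToType X) :
      OrbitRel n d X (preWord C ((C.data d).act y (sumPerm 1 σ)) r) (preWord C y (r ∘ σ.symm))

variable (C) in
/-- `∐ l, C(n + l) ⊗_{Σ_l} X ^ ⊠ l` on the simplicial level `d`. -/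
abbrev level (n : ℕ) (d : SimplexCategoryᵒᵖ) (X : B) : B :=
  TensorBase.quot (pre C n d X) (OrbitRel C n d X)

variable (C) in
/-- The class of `y ⊗ r`. -/
def word {n : ℕ} {d : SimplexCategoryᵒᵖ} {X : B} {l : ℕ} (y : (C.obj (n + l)).obj d)
    (r : Fin l → ToType X) : ToType (level C n d X) :=
  TensorBase.proj (pre C n d X) (OrbitRel C n d X) (preWord C y r)

theorem word_isMulti {n : ℕ} {d : SimplexCategoryᵒᵖ} {X : B} {l : ℕ}
    (y : (C.obj (n + l)).obj d) :
    TensorBase.IsMulti (fun _ : Fin l => X) (level C n d X) (word C y) :=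
  TensorBase.postcomp
    (TensorBase.word_isMulti (T := Σ l, (C.obj (n + l)).obj d) Sigma.fst X ⟨l, y⟩) _

theorem word_act {n : ℕ} {d : SimplexCategoryᵒᵖ} {X : B} {l : ℕ} (y : (C.obj (n + l)).obj d)
    (σ : Perm (Fin l)) (r : Fin l → ToType X) :
    word C ((C.data d).act y (sumPerm 1 σ)) r = word C y (r ∘ σ.symm) :=
  TensorBase.proj_eq (OrbitRel.intro y σ r)

theorem level_ext {n : ℕ} {d : SimplexCategoryᵒᵖ} {X Y : B} {f g : level C n d X ⟶ Y}
    (h : ∀ {l : ℕ} (y : (C.obj (n + l)).obj d) (r : Fin l → ToType X),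
      f (word C y r) = g (word C y r)) : f = g := by
  refine TensorBase.quot_ext fun v => ?_
  have key : TensorBase.proj (pre C n d X) (OrbitRel C n d X) ≫ f =
      TensorBase.proj (pre C n d X) (OrbitRel C n d X) ≫ g := by
    refine TensorBase.powers_ext fun t r => ?_
    rw [ConcreteCategory.comp_apply, ConcreteCategory.comp_apply]
    exact h t.2 r
  rw [← ConcreteCategory.comp_apply, key, ConcreteCategory.comp_apply]

/-- The map `y ⊗ r ↦ φ y ⊗ f r`. -/
def levelMap (n : ℕ) {d d' : SimplexCategoryᵒᵖ} (φ : d ⟶ d') {X X' : B} (f : X ⟶ X') :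
    level C n d X ⟶ level C n d' X' :=
  TensorBase.quotDesc
    (TensorBase.powersDesc (T := Σ l, (C.obj (n + l)).obj d)
      (fun t r => word C ((C.obj (n + t.1)).map φ t.2) (fun i => f (r i)))
      (fun t => TensorBase.precomp (word_isMulti _) (fun _ => f)))
    (by
      rintro _ _ ⟨y, σ, r⟩
      erw [TensorBase.powersDesc_word, TensorBase.powersDesc_word]
      dsimp only
      rw [C.map_act, word_act])

theorem levelMap_word (n : ℕ) {d d' : SimplexCategoryᵒᵖ} (φ : d ⟶ d') {X X' : B} (f : X ⟶ X')
    {l : ℕ} (y : (C.obj (n + l)).obj d) (r : Fin l → ToType X) :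
    levelMap n φ f (word C y r) = word C ((C.obj (n + l)).map φ y) (fun i => f (r i)) := by
  unfold levelMap
  erw [TensorBase.quotDesc_proj, TensorBase.powersDesc_word]

variable (C) in
/-- The simplicial object `D_n X = ∐ l, C(n + l) ⊗_{Σ_l} X ^ ⊠ l`. -/
def obj (n : ℕ) (X : SimplicialObject B) : SimplicialObject B where
  obj d := level C n d (X.obj d)
  map φ := levelMap n φ (X.map φ)
  map_id d := level_ext fun y r => by
    rw [levelMap_word]
    simp
  map_comp φ ψ := level_ext fun y r => by
    rw [ConcreteCategory.comp_apply, levelMap_word, levelMap_word, levelMap_word]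
    simp

end DFunctor

/-! ### The objects `D_n ⊗_C R` -/

namespace OperadAlgebra

/-- The relation `γ(y; 1, …, 1, z₁, …, z_l) ⊗ (r₁, …, r_l) ∼ y ⊗ (z₁ · r₁, …, z_l · r_l)`:
the two sides are the images of `y ⊗ (z₁ ⊗ r₁, …, z_l ⊗ r_l) ∈ D_n C R` under the two maps
`D_n C R ⟶ D_n R`, and `D_n C R` is generated by these elements. -/
inductive CoeqRel (R : OperadAlgebra C B) (n : ℕ) (d : SimplexCategoryᵒᵖ) :
    ToType (DFunctor.level C n d (R.obj.obj d)) →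
      ToType (DFunctor.level C n d (R.obj.obj d)) → Prop
  | intro {l : ℕ} {m : Fin l → ℕ} (y : (C.obj (n + l)).obj d) (z : ∀ j, (C.obj (m j)).obj d)
      (r : ∀ j, Fin (m j) → ToType (R.obj.obj d)) :
      CoeqRel R n d (DFunctor.word C ((C.data d).graft n y z) (concat r))
        (DFunctor.word C y (fun j => R.act (z j) (r j)))

/-- The class of `y ⊗ r` in `D_n ⊗_C R`. -/
def word (R : OperadAlgebra C B) {n : ℕ} {d : SimplexCategoryᵒᵖ} {l : ℕ}
    (y : (C.obj (n + l)).obj d) (r : Fin l → ToType (R.obj.obj d)) :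
    ToType (TensorBase.quot (DFunctor.level C n d (R.obj.obj d)) (R.CoeqRel n d)) :=
  TensorBase.proj (DFunctor.level C n d (R.obj.obj d)) (R.CoeqRel n d) (DFunctor.word C y r)

theorem word_graft (R : OperadAlgebra C B) {n : ℕ} {d : SimplexCategoryᵒᵖ} {l : ℕ}
    {m : Fin l → ℕ} (y : (C.obj (n + l)).obj d) (z : ∀ j, (C.obj (m j)).obj d)
    (r : ∀ j, Fin (m j) → ToType (R.obj.obj d)) :
    R.word ((C.data d).graft n y z) (concat r) = R.word y (fun j => R.act (z j) (r j)) :=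
  TensorBase.proj_eq (CoeqRel.intro y z r)

theorem tensor_ext (R : OperadAlgebra C B) {n : ℕ} {d : SimplexCategoryᵒᵖ} {Y : B}
    {f g : TensorBase.quot (DFunctor.level C n d (R.obj.obj d)) (R.CoeqRel n d) ⟶ Y}
    (h : ∀ {l : ℕ} (y : (C.obj (n + l)).obj d) (r : Fin l → ToType (R.obj.obj d)),
      f (R.word y r) = g (R.word y r)) : f = g := by
  refine TensorBase.quot_ext fun v => ?_
  have key : TensorBase.proj (DFunctor.level C n d (R.obj.obj d)) (R.CoeqRel n d) ≫ f =
      TensorBase.proj (DFunctor.level C n d (R.obj.obj d)) (R.CoeqRel n d) ≫ g := by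
    refine DFunctor.level_ext fun y r => ?_
    rw [ConcreteCategory.comp_apply, ConcreteCategory.comp_apply]
    exact h y r
  rw [← ConcreteCategory.comp_apply, key, ConcreteCategory.comp_apply]

/-- The map `y ⊗ r ↦ φ y ⊗ f r`. -/
def tensorMap {R R' : OperadAlgebra C B} (n : ℕ) {d d' : SimplexCategoryᵒᵖ} (φ : d ⟶ d')
    (f : R.obj.obj d ⟶ R'.obj.obj d')
    (hf : ∀ {k : ℕ} (x : (C.obj k).obj d) (r : Fin k → ToType (R.obj.obj d)),
      f (R.act x r) = R'.act ((C.obj k).map φ x) (fun i => f (r i))) :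
    TensorBase.quot (DFunctor.level C n d (R.obj.obj d)) (R.CoeqRel n d) ⟶
      TensorBase.quot (DFunctor.level C n d' (R'.obj.obj d')) (R'.CoeqRel n d') :=
  TensorBase.quotDesc (DFunctor.levelMap n φ f ≫ TensorBase.proj _ (R'.CoeqRel n d')) (by
    rintro _ _ ⟨y, z, r⟩
    rw [ConcreteCategory.comp_apply, ConcreteCategory.comp_apply, DFunctor.levelMap_word,
      DFunctor.levelMap_word, C.map_graft]
    refine (R'.word_graft ((C.obj _).map φ y) (fun j => (C.obj _).map φ (z j))
      (fun j i => f (r j i))).trans ?_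
    simp only [hf]
    rfl)

theorem tensorMap_word {R R' : OperadAlgebra C B} (n : ℕ) {d d' : SimplexCategoryᵒᵖ} (φ : d ⟶ d')
    (f : R.obj.obj d ⟶ R'.obj.obj d')
    (hf : ∀ {k : ℕ} (x : (C.obj k).obj d) (r : Fin k → ToType (R.obj.obj d)),
      f (R.act x r) = R'.act ((C.obj k).map φ x) (fun i => f (r i)))
    {l : ℕ} (y : (C.obj (n + l)).obj d) (r : Fin l → ToType (R.obj.obj d)) :
    tensorMap n φ f hf (R.word y r) =
      R'.word ((C.obj (n + l)).map φ y) (fun i => f (r i)) := by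
  unfold tensorMap word
  rw [TensorBase.quotDesc_proj, ConcreteCategory.comp_apply, DFunctor.levelMap_word]

/-- The simplicial object `D_n ⊗_C R`, the coequalizer of the two maps `D_n C R ⟶ D_n R`. -/
def tensor (R : OperadAlgebra C B) (n : ℕ) : SimplicialObject B where
  obj d := TensorBase.quot (DFunctor.level C n d (R.obj.obj d)) (R.CoeqRel n d)
  map φ := tensorMap n φ (R.obj.map φ) (R.map_act φ)
  map_id d := R.tensor_ext fun y r => by
    rw [tensorMap_word]
    simp
  map_comp φ ψ := R.tensor_ext fun y r => by
    rw [ConcreteCategory.comp_apply, tensorMap_word, tensorMap_word, tensorMap_word]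
    simp

/-- The projection of `D_n R` to `D_n ⊗_C R`. -/
def tensorProj (R : OperadAlgebra C B) (n : ℕ) : DFunctor.obj C n R.obj ⟶ R.tensor n where
  app d := TensorBase.proj (DFunctor.level C n d (R.obj.obj d)) (R.CoeqRel n d)
  naturality d d' φ := DFunctor.level_ext fun y r => by
    erw [ConcreteCategory.comp_apply, ConcreteCategory.comp_apply]
    refine Eq.trans ?_ (tensorMap_word n φ (R.obj.map φ) (R.map_act φ) y r).symm
    exact congrArg _ (DFunctor.levelMap_word n φ (R.obj.map φ) y r)

theorem Hom.map_act_id {R R' : OperadAlgebra C B} (f : Hom R R') {d : SimplexCategoryᵒᵖ} {k : ℕ}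
    (x : (C.obj k).obj d) (r : Fin k → ToType (R.obj.obj d)) :
    f.app.app d (R.act x r) = R'.act ((C.obj k).map (𝟙 d) x) (fun i => f.app.app d (r i)) := by
  rw [f.map_act]
  simp

/-- The map `D_n ⊗_C R ⟶ D_n ⊗_C R'` induced by a morphism of algebras. -/
def Hom.tensor {R R' : OperadAlgebra C B} (f : Hom R R') (n : ℕ) : R.tensor n ⟶ R'.tensor n where
  app d := tensorMap n (𝟙 d) (f.app.app d) f.map_act_id
  naturality d d' φ := R.tensor_ext fun y r => by
    erw [ConcreteCategory.comp_apply, ConcreteCategory.comp_apply]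
    refine (congrArg _ (tensorMap_word n φ (R.obj.map φ) (R.map_act φ) y r)).trans ?_
    refine (tensorMap_word n (𝟙 d') (f.app.app d') f.map_act_id _ _).trans ?_
    refine Eq.trans ?_ (congrArg _ (tensorMap_word n (𝟙 d) (f.app.app d) f.map_act_id y r)).symm
    refine Eq.trans ?_ (tensorMap_word n φ (R'.obj.map φ) (R'.map_act φ) _ _).symm
    congr 1
    · simp
    · funext i
      rw [← ConcreteCategory.comp_apply, ← ConcreteCategory.comp_apply, f.app.naturality]

end OperadAlgebra

/-! ### Fibered operads -/

variable (C B) in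
/-- The operations of an operad fibered over `C`: objects `Q(n)` fibered over `C(n)`, that is,
functors on the category of elements of `C(n)`; a unit over the unit of `C`; symmetric group
actions over those of `C`; and compositions
`Q(k)_x ⊠ Q(n₁)_{y₁} ⊠ ⋯ ⊠ Q(n_k)_{y_k} ⟶ Q(n₁ + ⋯ + n_k)_{γ(x; y₁, …, y_k)}`. -/
structure FiberedOperadData where
  obj : ∀ n, (C.obj n).Elements ⥤ B
  one : ∀ d, ToType ((obj 1).obj ⟨d, (C.data d).one⟩)
  act : ∀ {d : SimplexCategoryᵒᵖ} {n : ℕ} (x : (C.obj n).obj d) (σ : Perm (Fin n)),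
    (obj n).obj ⟨d, x⟩ ⟶ (obj n).obj ⟨d, (C.data d).act x σ⟩
  comp : ∀ {d : SimplexCategoryᵒᵖ} {k m : ℕ} {n : Fin k → ℕ} (h : ∑ j, n j = m)
    (x : (C.obj k).obj d) (y : ∀ j, (C.obj (n j)).obj d),
    ToType ((obj k).obj ⟨d, x⟩) → (∀ j, ToType ((obj (n j)).obj ⟨d, y j⟩)) →
      ToType ((obj m).obj ⟨d, (C.data d).comp h x y⟩)
  comp_isMulti : ∀ {d : SimplexCategoryᵒᵖ} {k m : ℕ} {n : Fin k → ℕ} (h : ∑ j, n j = m)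
    (x : (C.obj k).obj d) (y : ∀ j, (C.obj (n j)).obj d),
    TensorBase.IsMulti
      (fun o : Option (Fin k) =>
        (o.elim ((obj k).obj ⟨d, x⟩) (fun j => (obj (n j)).obj ⟨d, y j⟩) : B))
      ((obj m).obj ⟨d, (C.data d).comp h x y⟩)
      (fun v => comp h x y (v none) (fun j => v (some j)))

namespace FiberedOperadData

/-- The elements of all fibres of `Q(n)` on the simplicial level `d`. -/
abbrev Total (Q : FiberedOperadData C B) (d : SimplexCategoryᵒᵖ) (n : ℕ) : Type u :=
  Σ x : (C.obj n).obj d, ToType ((Q.obj n).obj ⟨d, x⟩)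

/-- The simplicial structure on the elements of all fibres. -/
def totalMap (Q : FiberedOperadData C B) {d d' : SimplexCategoryᵒᵖ} (φ : d ⟶ d') (n : ℕ)
    (q : Q.Total d n) : Q.Total d' n :=
  ⟨(C.obj n).map φ q.1,
    (Q.obj n).map (CategoryOfElements.homMk (F := C.obj n) ⟨d, q.1⟩ ⟨d', (C.obj n).map φ q.1⟩ φ rfl)
      q.2⟩

/-- The operations of `Q` on the elements of all fibres. -/
def total (Q : FiberedOperadData C B) (d : SimplexCategoryᵒᵖ) : OperadData (Q.Total d) where
  one := ⟨(C.data d).one, Q.one d⟩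
  act q σ := ⟨(C.data d).act q.1 σ, Q.act q.1 σ q.2⟩
  comp h q q' := ⟨(C.data d).comp h q.1 (fun j => (q' j).1),
    Q.comp h q.1 (fun j => (q' j).1) q.2 (fun j => (q' j).2)⟩

end FiberedOperadData

variable (C B) in
/-- An operad fibered over `C`: the operations satisfy the operad axioms and are natural in the
simplicial direction. (The equations are between elements of all fibres; their first components
are the corresponding equations in `C`.) -/
structure FiberedOperad extends FiberedOperadData C B where
  isOperad : ∀ d, (toFiberedOperadData.total d).IsOperad
  map_one : ∀ {d d' : SimplexCategoryᵒᵖ} (φ : d ⟶ d'),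
    toFiberedOperadData.totalMap φ 1 (toFiberedOperadData.total d).one =
      (toFiberedOperadData.total d').one
  map_act : ∀ {d d' : SimplexCategoryᵒᵖ} (φ : d ⟶ d') {n : ℕ} (q : toFiberedOperadData.Total d n)
    (σ : Perm (Fin n)),
    toFiberedOperadData.totalMap φ n ((toFiberedOperadData.total d).act q σ) =
      (toFiberedOperadData.total d').act (toFiberedOperadData.totalMap φ n q) σ
  map_comp : ∀ {d d' : SimplexCategoryᵒᵖ} (φ : d ⟶ d') {k m : ℕ} {n : Fin k → ℕ}
    (h : ∑ j, n j = m) (q : toFiberedOperadData.Total d k)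
    (q' : ∀ j, toFiberedOperadData.Total d (n j)),
    toFiberedOperadData.totalMap φ m ((toFiberedOperadData.total d).comp h q q') =
      (toFiberedOperadData.total d').comp h (toFiberedOperadData.totalMap φ k q)
        (fun j => toFiberedOperadData.totalMap φ (n j) (q' j))

/-- A morphism of operads fibered over `C`. -/
@[ext]
structure FiberedOperad.Hom (Q Q' : FiberedOperad C B) where
  app : ∀ n, Q.obj n ⟶ Q'.obj n
  map_one : ∀ d, (app 1).app ⟨d, (C.data d).one⟩ (Q.one d) = Q'.one d
  map_act : ∀ {d : SimplexCategoryᵒᵖ} {n : ℕ} (x : (C.obj n).obj d) (σ : Perm (Fin n))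
    (q : ToType ((Q.obj n).obj ⟨d, x⟩)),
    (app n).app ⟨d, (C.data d).act x σ⟩ (Q.act x σ q) = Q'.act x σ ((app n).app ⟨d, x⟩ q)
  map_comp : ∀ {d : SimplexCategoryᵒᵖ} {k m : ℕ} {n : Fin k → ℕ} (h : ∑ j, n j = m)
    (x : (C.obj k).obj d) (y : ∀ j, (C.obj (n j)).obj d)
    (q : ToType ((Q.obj k).obj ⟨d, x⟩)) (q' : ∀ j, ToType ((Q.obj (n j)).obj ⟨d, y j⟩)),
    (app m).app ⟨d, (C.data d).comp h x y⟩ (Q.comp h x y q q') =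
      Q'.comp h x y ((app k).app ⟨d, x⟩ q) (fun j => (app (n j)).app ⟨d, y j⟩ (q' j))

/-- `Q`, with the comparison maps `α n : Q(n)_x ⟶ D_n ⊗_C R`, is the canonical structure of an
operad fibered over `C` on the objects `D_n ⊗_C R`. -/
structure IsCanonicalStructure [∀ d, Unique ((C.obj 0).obj d)] (R : OperadAlgebra C B)
    (Q : FiberedOperad C B)
    (α : ∀ n, Q.obj n ⟶ CategoryOfElements.π (C.obj n) ⋙ R.tensor n) : Prop where
  /-- `D_n ⊗_C R` is, on each simplicial level, the coproduct of the fibres of `Q(n)`. -/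
  coproduct : ∀ (n : ℕ) (d : SimplexCategoryᵒᵖ),
    Nonempty (IsColimit (Cofan.mk ((R.tensor n).obj d)
      (fun x : (C.obj n).obj d => ((α n).app ⟨d, x⟩ : (Q.obj n).obj ⟨d, x⟩ ⟶ (R.tensor n).obj d))))
  /-- The class of `y ⊗ r` lies in the fibre over `γ(y; 1, …, 1, *, …, *)`. -/
  fibre : ∀ {n : ℕ} {d : SimplexCategoryᵒᵖ} {l : ℕ} (y : (C.obj (n + l)).obj d)
    (r : Fin l → ToType (R.obj.obj d)),
    ∃ q : ToType ((Q.obj n).obj ⟨d, (C.data d).cap default n y⟩),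
      (α n).app ⟨d, (C.data d).cap default n y⟩ q = R.word y r
  /-- The unit is the class of `1 ∈ C(1)`. -/
  one : ∀ d, (α 1).app ⟨d, (C.data d).one⟩ (Q.one d) =
    R.word (n := 1) (l := 0) (C.data d).one Fin.elim0
  /-- The symmetric group `Σ_n` acts through the first `n` inputs. -/
  act : ∀ {d : SimplexCategoryᵒᵖ} {n : ℕ} (x : (C.obj n).obj d) (σ : Perm (Fin n))
    (q : ToType ((Q.obj n).obj ⟨d, x⟩)) {l : ℕ} (y : (C.obj (n + l)).obj d)
    (r : Fin l → ToType (R.obj.obj d)), (α n).app ⟨d, x⟩ q = R.word y r →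
    (α n).app ⟨d, (C.data d).act x σ⟩ (Q.act x σ q) =
      R.word ((C.data d).act y (sumPerm σ 1)) r
  /-- The composition of `y ⊗ r` with `y₁ ⊗ r₁, …, y_k ⊗ r_k` is obtained by applying the operad
  composition of `C` and grouping together `r, r₁, …, r_k`. -/
  comp : ∀ {d : SimplexCategoryᵒᵖ} {k m : ℕ} {n : Fin k → ℕ} (h : ∑ j, n j = m)
    (x : (C.obj k).obj d) (x' : ∀ j, (C.obj (n j)).obj d)
    (q : ToType ((Q.obj k).obj ⟨d, x⟩)) (q' : ∀ j, ToType ((Q.obj (n j)).obj ⟨d, x' j⟩))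
    {l : ℕ} {p : Fin k → ℕ} (y : (C.obj (k + l)).obj d) (y' : ∀ j, (C.obj (n j + p j)).obj d)
    (r : Fin l → ToType (R.obj.obj d)) (r' : ∀ j, Fin (p j) → ToType (R.obj.obj d)),
    (α k).app ⟨d, x⟩ q = R.word y r →
    (∀ j, (α (n j)).app ⟨d, x' j⟩ (q' j) = R.word (y' j) (r' j)) →
    (α m).app ⟨d, (C.data d).comp h x x'⟩ (Q.comp h x x' q q') =
      R.word ((C.data d).compSplit h y y') (Fin.append r (concat r'))

end

end

/-!
An element of `D_n ⊗_C R` is represented by words `y ⊗ r`, with `y ∈ C(n + l)` and `r ∈ R ^ l`, and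
the formulas for unit, symmetric group actions and composition define an operad structure on words.
The proof has to show that this structure descends to `D_n ⊗_C R`, that it satisfies the operad
axioms there, and that it respects a decomposition of `D_n ⊗_C R` into fibres over `C(n)`.

*Identities between words.* Instead of computing with permutations, an identity between operations
of an operad in sets is tested on its algebras in sets, where `act_graft`, `act_cap` and
`act_compSplit` say that grafting is substitution of functions. This is justified by the free
algebra `∐ k, C(k) ×_{Σ_k} V ^ k`: operations acting equally on all algebras are equal
(`IsOperad.eq_of_act_eq`), and words defining equal functions on all algebras differ by a
permutation of their last inputs (`IsOperad.exists_perm_of_eval_eq`), hence have the same class.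
Block permutations and bracketings then enter only through the effect of an operad axiom on
variables; the one delicate point is that the slots of an iterated composite are numbered in the
same way for both bracketings, because both numberings are lexicographic (`finSigmaFinEquiv_assoc`).

*Passage to `D_n ⊗_C R`.* The relation `Reduces` between words (evaluate some operations of `C` on
elements of `R`) identifies classes and is stable under the operations, in particular under
composition in all variables (`Reduces.comp`). In sets and in modules over a field, a
multimorphism can be defined and compared on generators, one variable at a time; these and the
other properties of the ground category that are needed form the class `TensorBase.Concrete`. So
the operations on words extend to `D_n ⊗_C R` (`exists_comp`, `exists_act`), and each operad axiom
follows from the identity between words (`tensorOperad_isOperad`).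

*Fibres.* The word `y ⊗ r` is given the base point `γ(y; 1, …, 1, *, …, *)`. As `C(0)` is a point,
reductions do not change it (`Reduces.base_eq`), so `D_n ⊗_C R` is the coproduct of fibres generated
by the words with a given base point (`exists_isFibreFamily`); the operations on words lie over those
of `C`, whence they restrict to fibres (`exists_fibre_comp`).

*Morphisms.* In any structure as described, the fibres inject into `D_n ⊗_C R`, are generated by
classes of words, and carry the operations restricted from `D_n ⊗_C R`
(`IsCanonicalStructure.app_comp`). Since `D_n ⊗_C f` preserves base points, it restricts uniquely to
the fibres, and the restriction is a morphism of operads (`IsCanonicalStructure.existsUnique_hom`).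
-/

/-! ### Algebras in sets -/

namespace OperadData

/-- An algebra in sets over an operad in sets. -/
structure SetAlgebra {P : ℕ → Type u} (C : OperadData P) where
  carrier : Type u
  act : ∀ {n : ℕ}, P n → (Fin n → carrier) → carrier
  one_act : ∀ r : Fin 1 → carrier, act C.one r = r 0
  act_act : ∀ {n : ℕ} (x : P n) (σ : Perm (Fin n)) (r : Fin n → carrier),
    act (C.act x σ) r = act x (r ∘ σ.symm)
  comp_act : ∀ {k m : ℕ} {n : Fin k → ℕ} (h : ∑ j, n j = m) (x : P k) (y : ∀ j, P (n j))
    (r : Fin m → carrier),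
    act (C.comp h x y) r = act x (fun j => act (y j) (fun l => r (blocks h ⟨j, l⟩)))

variable {P : ℕ → Type u} {C : OperadData P}

namespace SetAlgebra

variable (A : C.SetAlgebra)

/-- The input `⟨j, l⟩` of `compAt a e x y` is its input number `e ⟨j, l⟩`. -/
theorem act_compAt {J : Type} {k m : ℕ} {n : J → ℕ} (a : J ≃ Fin k) (e : Slots n ≃ Fin m)
    (x : P k) (y : ∀ j, P (n j)) (v : Fin m → A.carrier) :
    A.act (C.compAt a e x y) v =
      A.act x (fun i => A.act (y (a.symm i)) (fun l => v (e ⟨a.symm i, l⟩))) := by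
  rw [compAt, A.act_act, A.comp_act]
  congr 1
  funext i
  congr 1
  funext l
  simp

theorem act_sumPerm {n l : ℕ} (y : P (n + l)) (σ : Perm (Fin n)) (τ : Perm (Fin l))
    (v : Fin n → A.carrier) (w : Fin l → A.carrier) :
    A.act (C.act y (sumPerm σ τ)) (Fin.append v w) =
      A.act y (Fin.append (v ∘ σ.symm) (w ∘ τ.symm)) := by
  rw [A.act_act]
  congr 1
  funext i
  obtain ⟨i, rfl⟩ := finSumFinEquiv.surjective i
  have hi : (sumPerm σ τ).symm (finSumFinEquiv i) = finSumFinEquiv (i.map σ.symm τ.symm) := by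
    rw [Equiv.symm_apply_eq, sumPerm, Equiv.permCongr_apply, Equiv.symm_apply_apply]
    rcases i with i | i <;> simp
  rw [Function.comp_apply, hi]
  rcases i with i | i <;> simp

theorem act_graft (n : ℕ) {l : ℕ} {m : Fin l → ℕ} (y : P (n + l)) (z : ∀ j, P (m j))
    (v : Fin n → A.carrier) (w : Fin (∑ j, m j) → A.carrier) :
    A.act (C.graft n y z) (Fin.append v w) =
      A.act y (Fin.append v (fun j => A.act (z j) (fun i => w (finSigmaFinEquiv ⟨j, i⟩)))) := by
  rw [graft, A.act_compAt]
  congr 1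
  funext i
  obtain ⟨i, rfl⟩ := finSumFinEquiv.surjective i
  rw [Equiv.symm_apply_apply]
  rcases i with i | i
  · exact (A.one_act _).trans ((Fin.append_left v w i).trans (Fin.append_left v _ i).symm)
  · conv_rhs => rw [finSumFinEquiv_apply_right, Fin.append_right]
    exact congrArg (A.act (z i)) (funext fun q => Fin.append_right v w _)

theorem act_cap (pt : P 0) (n : ℕ) {l : ℕ} (y : P (n + l)) (v : Fin n → A.carrier) :
    A.act (C.cap pt n y) v = A.act y (Fin.append v (fun _ => A.act pt Fin.elim0)) := by
  rw [cap, A.act_compAt]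
  congr 1
  funext i
  obtain ⟨i, rfl⟩ := finSumFinEquiv.surjective i
  rw [Equiv.symm_apply_apply]
  rcases i with i | i
  · exact (A.one_act _).trans (Fin.append_left v _ i).symm
  · conv_rhs => rw [finSumFinEquiv_apply_right, Fin.append_right]
    exact congrArg (A.act pt) (funext fun q => Fin.elim0 q)

/-- The composite of `v ↦ y(v, s)` with the functions `v ↦ z j (v, w j)`: on an algebra, the
reordering of the inputs in `compSplit` only says which variables are inserted where. -/
theorem act_compSplit {k l m : ℕ} {n p : Fin k → ℕ} (h : ∑ j, n j = m) (y : P (k + l))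
    (z : ∀ j, P (n j + p j)) (v : Fin m → A.carrier) (s : Fin l → A.carrier)
    (w : Fin (∑ j, p j) → A.carrier) :
    A.act (C.compSplit h y z) (Fin.append v (Fin.append s w)) =
      A.act y (Fin.append (fun j => A.act (z j) (Fin.append (fun i => v (blocks h ⟨j, i⟩))
        (fun i => w (finSigmaFinEquiv ⟨j, i⟩)))) s) := by
  rw [compSplit, A.act_compAt]
  congr 1
  funext i
  obtain ⟨i, rfl⟩ := finSumFinEquiv.surjective i
  rw [Equiv.symm_apply_apply]
  rcases i with i | i
  · conv_rhs => rw [finSumFinEquiv_apply_left, Fin.append_left]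
    refine congrArg (A.act (z i)) (funext fun q => ?_)
    obtain ⟨q, rfl⟩ := finSumFinEquiv.surjective q
    have hs : slotsAdd n p ⟨i, finSumFinEquiv q⟩ = q.map (Sigma.mk i) (Sigma.mk i) := by
      rcases q with q | q <;> simp [slotsAdd]
    have hq : slotsSum (fun j => n j + p j) (fun _ : Fin l => 1)
        ⟨Sum.inl i, finSumFinEquiv q⟩ = Sum.inl ⟨i, finSumFinEquiv q⟩ := rfl
    rw [Equiv.trans_apply, hq, Equiv.trans_apply, Equiv.sumCongr_apply, Sum.map_inl, hs]
    rcases q with q | q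
    · conv_rhs => rw [finSumFinEquiv_apply_left, Fin.append_left]
      exact Fin.append_left v _ _
    · conv_rhs => rw [finSumFinEquiv_apply_right, Fin.append_right]
      exact (Fin.append_right v _ _).trans (Fin.append_right s w _)
  · exact (A.one_act _).trans ((Fin.append_right v _ _).trans
      ((Fin.append_left s w i).trans (Fin.append_right _ _ i).symm))

end SetAlgebra

end OperadData

/-! ### Blocks of inputs -/

/-- Slots are listed in lexicographic order. -/
theorem finSigmaFinEquiv_lt_iff {k : ℕ} {n : Fin k → ℕ} {s t : Slots n} :
    finSigmaFinEquiv s < finSigmaFinEquiv t ↔ s.1 < t.1 ∨ s.1 = t.1 ∧ (s.2 : ℕ) < t.2 := by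
  have key : ∀ a : Fin k, ∑ i : Fin a, n (Fin.castLE a.2.le i) =
      ∑ i ∈ Finset.univ.filter (· < a), n i := by
    intro a
    refine Finset.sum_bij (fun i _ => Fin.castLE a.2.le i) ?_ ?_ ?_ ?_
    · intro i _
      exact Finset.mem_filter.2 ⟨Finset.mem_univ _, i.2⟩
    · intro i _ j _ hij
      simpa using hij
    · intro i hi
      exact ⟨⟨i, (Finset.mem_filter.1 hi).2⟩, by simp, rfl⟩
    · simp
  have lt : ∀ {s t : Slots n}, (s.1 < t.1 ∨ s.1 = t.1 ∧ (s.2 : ℕ) < t.2) →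
      finSigmaFinEquiv s < finSigmaFinEquiv t := by
    rintro ⟨i, q⟩ ⟨j, r⟩ h
    rw [Fin.lt_def, finSigmaFinEquiv_apply, finSigmaFinEquiv_apply, key, key]
    rcases h with h | ⟨e, h⟩
    · dsimp only at h ⊢
      have hi : i ∉ Finset.univ.filter (· < i) := by simp
      have hsub : insert i (Finset.univ.filter (· < i)) ⊆ Finset.univ.filter (· < j) := by
        intro a ha
        rcases Finset.mem_insert.1 ha with rfl | ha
        · simpa using h
        · simpa using lt_trans (by simpa using ha) h
      have := Finset.sum_le_sum_of_subset (f := n) hsub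
      rw [Finset.sum_insert hi] at this
      have := q.2
      omega
    · dsimp only at e h ⊢
      subst e
      omega
  refine ⟨fun h => ?_, lt⟩
  rcases lt_trichotomy s.1 t.1 with h' | h' | h'
  · exact Or.inl h'
  · refine Or.inr ⟨h', ?_⟩
    by_contra hcon
    rcases (not_lt.1 hcon).lt_or_eq with hc | hc
    · exact (lt (Or.inr ⟨h'.symm, hc⟩)).asymm h
    · obtain ⟨i, q⟩ := s
      obtain ⟨j, r⟩ := t
      obtain rfl : i = j := h'
      obtain rfl : r = q := Fin.ext hc
      exact lt_irrefl _ h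
  · exact absurd h (lt (Or.inl h')).asymm

/-- Listing blocks of blocks one after the other does not depend on the bracketing. -/
theorem finSigmaFinEquiv_assoc {k m : ℕ} {n : Fin k → ℕ} (h : ∑ j, n j = m)
    (p : ∀ j, Fin (n j) → ℕ) (i : Fin m)
    (q : Fin (p ((blocks h).symm i).1 ((blocks h).symm i).2)) :
    (finSigmaFinEquiv (n := fun i => p ((blocks h).symm i).1 ((blocks h).symm i).2) ⟨i, q⟩ : ℕ) =
      finSigmaFinEquiv (n := fun j => ∑ l, p j l)
        ⟨((blocks h).symm i).1, finSigmaFinEquiv ⟨((blocks h).symm i).2, q⟩⟩ := by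
  subst h
  let e : (Σ i, Fin (p ((blocks rfl).symm i).1 ((blocks rfl).symm i).2)) ≃
      Fin (∑ j, ∑ l, p j l) :=
    (Equiv.sigmaCongrLeft (β := fun s : Slots n => Fin (p s.1 s.2)) (blocks rfl).symm).trans
      ((Equiv.sigmaAssoc fun j l => Fin (p j l)).trans
        ((Equiv.sigmaCongrRight fun j => finSigmaFinEquiv).trans finSigmaFinEquiv))
  -- Both listings are lexicographic, so that the bijection between them is monotone.
  have hmono : StrictMono (finSigmaFinEquiv.symm.trans e) := by
    intro a b hab
    obtain ⟨⟨i, q⟩, rfl⟩ := finSigmaFinEquiv.surjective a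
    obtain ⟨⟨j, r⟩, rfl⟩ := finSigmaFinEquiv.surjective b
    rw [finSigmaFinEquiv_lt_iff] at hab
    simp only [Equiv.trans_apply, Equiv.symm_apply_apply]
    change finSigmaFinEquiv (n := fun j => ∑ l, p j l) ⟨_, finSigmaFinEquiv ⟨_, q⟩⟩ <
      finSigmaFinEquiv (n := fun j => ∑ l, p j l) ⟨_, finSigmaFinEquiv ⟨_, r⟩⟩
    rw [finSigmaFinEquiv_lt_iff]
    rcases hab with hab | ⟨rfl, hab⟩
    · obtain ⟨s, rfl⟩ := (blocks rfl).surjective i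
      obtain ⟨t, rfl⟩ := (blocks rfl).surjective j
      replace hab := finSigmaFinEquiv_lt_iff.1 hab
      dsimp only at q r ⊢
      revert q r
      rw [Equiv.symm_apply_apply, Equiv.symm_apply_apply]
      intro q r
      refine hab.imp id fun h => ⟨h.1, ?_⟩
      obtain ⟨i, i'⟩ := s
      obtain ⟨j, j'⟩ := t
      obtain ⟨rfl, h⟩ : i = j ∧ _ := h
      exact finSigmaFinEquiv_lt_iff.2 (Or.inl h)
    · exact Or.inr ⟨rfl, finSigmaFinEquiv_lt_iff.2 (Or.inr ⟨rfl, hab⟩)⟩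
  have := Fin.coe_orderIso_apply (hmono.orderIsoOfSurjective _ (Equiv.surjective _))
    (finSigmaFinEquiv ⟨i, q⟩)
  rw [← this]
  rw [StrictMono.coe_orderIsoOfSurjective, Equiv.trans_apply, Equiv.symm_apply_apply]
  rfl

theorem concat_blocks {k : ℕ} {n : Fin k → ℕ} {X : Type u} (r : ∀ j, Fin (n j) → X) (j : Fin k)
    (i : Fin (n j)) : concat r (finSigmaFinEquiv ⟨j, i⟩) = r j i := by
  change (fun s : Slots n => r s.1 s.2) (finSigmaFinEquiv.symm (finSigmaFinEquiv ⟨j, i⟩)) = _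
  rw [Equiv.symm_apply_apply]

theorem blocks_unit_left {n : ℕ} (h : ∑ _j : Fin 1, n = n) (j : Fin 1) (i : Fin n) :
    blocks h ⟨j, i⟩ = i :=
  Fin.ext (finSigmaFinEquiv_one (n := fun _ => n) ⟨j, i⟩)

theorem blocks_unit_right {n : ℕ} (h : ∑ _j : Fin n, 1 = n) (j : Fin n) (i : Fin 1) :
    blocks h ⟨j, i⟩ = j :=
  Fin.ext (by simp [blocks, Subsingleton.elim i 0])

theorem blockPerm_symm_blocks {k m : ℕ} {n : Fin k → ℕ} (σ : Perm (Fin k)) (h : ∑ j, n j = m)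
    (h' : ∑ j, n (σ.symm j) = m) (j : Fin k) (i : Fin (n (σ.symm j))) :
    (blockPerm σ h h').symm (blocks h' ⟨j, i⟩) = blocks h ⟨σ.symm j, i⟩ := by
  rw [Equiv.symm_apply_eq]
  simp only [blockPerm, Equiv.trans_apply, Equiv.symm_apply_apply]
  congr 1
  rw [Equiv.eq_symm_apply]
  rfl

theorem permCongr_symm_blocks {k m : ℕ} {n : Fin k → ℕ} (h : ∑ j, n j = m)
    (τ : ∀ j, Perm (Fin (n j))) (j : Fin k) (i : Fin (n j)) :
    ((blocks h).permCongr (Equiv.sigmaCongrRight τ)).symm (blocks h ⟨j, i⟩) =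
      blocks h ⟨j, (τ j).symm i⟩ := by
  rw [Equiv.symm_apply_eq, Equiv.permCongr_apply]
  simp

/-! ### Free algebras in sets -/

namespace OperadData

variable {P : ℕ → Type u} (C : OperadData P) (V : Type u)

/-- An operation together with an assignment of elements of `V` to its inputs. -/
abbrev FreeWord (P : ℕ → Type u) (V : Type u) : Type u := Σ k, P k × (Fin k → V)

/-- The words `x σ ⊗ f` and `x ⊗ f σ⁻¹` are equivalent. This is the equivalence relation defining
`C(k) ×_{Σ_k} V ^ k`, not merely a set of generators of it, since the symmetric groups act. -/
inductive FreeRel : FreeWord P V → FreeWord P V → Prop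
  | intro {k : ℕ} (x : P k) (σ : Perm (Fin k)) (f : Fin k → V) :
      FreeRel ⟨k, C.act x σ, f⟩ ⟨k, x, f ∘ σ.symm⟩

variable {C V}

theorem IsOperad.freeRel_equivalence (hC : C.IsOperad) : Equivalence (FreeRel C V) where
  refl := by
    rintro ⟨k, x, f⟩
    have := FreeRel.intro (C := C) x 1 f
    rwa [hC.act_one] at this
  symm := by
    rintro _ _ ⟨x, σ, f⟩
    have := FreeRel.intro (C := C) (C.act x σ) σ⁻¹ (f ∘ σ.symm)
    rw [← hC.act_mul, mul_inv_cancel, hC.act_one] at this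
    convert! this
    funext i
    simp [Perm.inv_def]
  trans := by
    rintro _ _ _ ⟨x, σ, f⟩ h
    generalize hf : f ∘ σ.symm = g at h
    cases h with
    | intro y τ =>
      subst hf
      rw [← hC.act_mul]
      exact FreeRel.intro y (τ * σ) f

theorem FreeRel.exists_perm {k : ℕ} {x x' : P k} {f f' : Fin k → V}
    (h : FreeRel C V ⟨k, x, f⟩ ⟨k, x', f'⟩) :
    ∃ σ : Perm (Fin k), x = C.act x' σ ∧ f' = f ∘ σ.symm := by
  cases h with
  | intro x σ f => exact ⟨σ, rfl, rfl⟩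

theorem FreeRel.arity_eq {a b : FreeWord P V} (h : FreeRel C V a b) : a.1 = b.1 := by
  cases h
  rfl

/-- The composite of an operation with words. -/
def freeOp (C : OperadData P) {k : ℕ} (x : P k) (a : Fin k → FreeWord P V) : FreeWord P V :=
  ⟨∑ j, (a j).1, C.comp rfl x (fun j => (a j).2.1), concat fun j => (a j).2.2⟩

/-- `freeOp` respects the equivalence of words, by equivariance in the inserted operations. -/
theorem IsOperad.freeOp_rel (hC : C.IsOperad) {k : ℕ} (x : P k) {a b : Fin k → FreeWord P V}
    (h : ∀ j, FreeRel C V (a j) (b j)) : FreeRel C V (freeOp C x a) (freeOp C x b) := by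
  obtain ⟨n, p, f, rfl⟩ : ∃ (n : Fin k → ℕ) (p : ∀ j, P (n j)) (f : ∀ j, Fin (n j) → V),
    a = fun j => ⟨n j, p j, f j⟩ := ⟨fun j => (a j).1, fun j => (a j).2.1, fun j => (a j).2.2, rfl⟩
  obtain ⟨n', p', f', rfl⟩ : ∃ (n : Fin k → ℕ) (p : ∀ j, P (n j)) (f : ∀ j, Fin (n j) → V),
    b = fun j => ⟨n j, p j, f j⟩ := ⟨fun j => (b j).1, fun j => (b j).2.1, fun j => (b j).2.2, rfl⟩
  obtain rfl : n = n' := funext fun j => (h j).arity_eq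
  choose σ hp hf using fun j => (h j).exists_perm
  obtain rfl : p = fun j => C.act (p' j) (σ j) := funext hp
  obtain rfl : f' = fun j => f j ∘ (σ j).symm := funext hf
  have := FreeRel.intro (C := C) (C.comp rfl x p')
    ((blocks rfl).permCongr (Equiv.sigmaCongrRight σ)) (concat f)
  rw [← hC.comp_act] at this
  refine Eq.subst (motive := fun g => FreeRel C V _ ⟨_, _, g⟩) (funext fun i => ?_) this
  obtain ⟨⟨j, i⟩, rfl⟩ := finSigmaFinEquiv.surjective i
  have hi := permCongr_symm_blocks rfl σ j i
  exact (congrArg _ hi).trans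
    ((concat_blocks f j _).trans (concat_blocks (fun j => f j ∘ (σ j).symm) j i).symm)

/-- Comparison of `freeOp` with a word whose arity is only propositionally the sum of the arities. -/
theorem freeOp_eq {k m : ℕ} {x : P k} {a : Fin k → FreeWord P V} (h : ∑ j, (a j).1 = m)
    {w : P m} {f : Fin m → V} (hx : C.comp h x (fun j => (a j).2.1) = w)
    (hf : ∀ j i, f (blocks h ⟨j, i⟩) = (a j).2.2 i) : freeOp C x a = ⟨m, w, f⟩ := by
  subst h hx
  refine congrArg (fun g => (⟨_, _, g⟩ : FreeWord P V)) (funext fun i => ?_)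
  obtain ⟨⟨j, i⟩, rfl⟩ := finSigmaFinEquiv.surjective i
  exact (concat_blocks (fun j => (a j).2.2) j i).trans (hf j i).symm

theorem IsOperad.freeOp_one (hC : C.IsOperad) (w : FreeWord P V) :
    freeOp C C.one (fun _ => w) = w := by
  obtain ⟨m, x, f⟩ := w
  refine freeOp_eq (by simp) (hC.one_comp _ x) fun j i => congrArg f ?_
  exact blocks_unit_left _ _ i

theorem IsOperad.freeOp_act (hC : C.IsOperad) {k : ℕ} (x : P k) (σ : Perm (Fin k))
    (a : Fin k → FreeWord P V) :
    FreeRel C V (freeOp C (C.act x σ) a) (freeOp C x (a ∘ σ.symm)) := by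
  have h' : ∑ j, (a (σ.symm j)).1 = ∑ j, (a j).1 := Equiv.sum_comp σ.symm fun j => (a j).1
  have := FreeRel.intro (C := C) (C.comp h' x (fun j => (a (σ.symm j)).2.1))
    (blockPerm σ rfl h') (concat fun j => (a j).2.2)
  rw [← hC.act_comp (n := fun j => (a j).1) rfl σ h' x fun j => (a j).2.1] at this
  refine Eq.subst (motive := FreeRel C V _) (Eq.symm (freeOp_eq h' rfl fun j i => ?_)) this
  exact (congrArg _ (blockPerm_symm_blocks (n := fun j => (a j).1) σ rfl h' j i)).trans
    (concat_blocks (fun j => (a j).2.2) _ i)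

theorem IsOperad.freeOp_comp (hC : C.IsOperad) {k m : ℕ} {n : Fin k → ℕ} (h : ∑ j, n j = m)
    (x : P k) (y : ∀ j, P (n j)) (b : Slots n → FreeWord P V) :
    freeOp C (C.comp h x y) (fun i => b ((blocks h).symm i)) =
      freeOp C x (fun j => freeOp C (y j) (fun l => b ⟨j, l⟩)) := by
  have h₁ : ∑ i, (b ((blocks h).symm i)).1 = ∑ j, ∑ l, (b ⟨j, l⟩).1 :=
    (Equiv.sum_comp (blocks h).symm fun s => (b s).1).trans (Fintype.sum_sigma _)
  refine freeOp_eq h₁ (hC.assoc h h₁ rfl x y fun j l => (b ⟨j, l⟩).2.1) fun i q => ?_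
  have hi : blocks h₁ ⟨i, q⟩ = finSigmaFinEquiv (n := fun j => ∑ l, (b ⟨j, l⟩).1)
      ⟨((blocks h).symm i).1, finSigmaFinEquiv ⟨((blocks h).symm i).2, q⟩⟩ :=
    Fin.ext (finSigmaFinEquiv_assoc h (fun j l => (b ⟨j, l⟩).1) i q)
  rw [hi]
  exact (concat_blocks (fun j => concat fun l => (b ⟨j, l⟩).2.2) _ _).trans
    (concat_blocks (fun l => (b ⟨_, l⟩).2.2) _ q)

variable (V) in
/-- Words up to a renumbering of the inputs. -/
abbrev IsOperad.freeSetoid (hC : C.IsOperad) : Setoid (FreeWord P V) :=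
  ⟨FreeRel C V, hC.freeRel_equivalence⟩

theorem IsOperad.freeSetoid_out (hC : C.IsOperad) (w : FreeWord P V) :
    FreeRel C V (Quotient.mk (hC.freeSetoid V) w).out w :=
  Quotient.exact (s := hC.freeSetoid V) (Quotient.out_eq _)

variable (V) in
/-- The free algebra `∐ k, C(k) ×_{Σ_k} V ^ k` on the set `V`. -/
noncomputable def IsOperad.freeAlgebra (hC : C.IsOperad) : C.SetAlgebra where
  carrier := Quotient (hC.freeSetoid V)
  act x t := Quotient.mk _ (freeOp C x fun j => (t j).out)
  one_act t := by
    have : (fun j => (t j).out) = fun _ => (t 0).out := funext fun j => by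
      rw [Subsingleton.elim j 0]
    rw [this, hC.freeOp_one, Quotient.out_eq]
  act_act x σ t := Quotient.sound (hC.freeOp_act x σ _)
  comp_act h x y t := by
    have := hC.freeOp_comp h x y fun s => (t (blocks h s)).out
    simp only [Equiv.apply_symm_apply] at this
    rw [this]
    exact Quotient.sound (hC.freeRel_equivalence.symm
      (hC.freeOp_rel x fun j => hC.freeSetoid_out _))

theorem IsOperad.freeAlgebra_act_mk (hC : C.IsOperad) {k : ℕ} (x : P k)
    (a : Fin k → FreeWord P V) :
    (hC.freeAlgebra V).act x (fun j => Quotient.mk _ (a j)) = Quotient.mk _ (freeOp C x a) :=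
  Quotient.sound (hC.freeOp_rel x fun _ => hC.freeSetoid_out _)

/-- An operation of the free algebra, applied to generators. -/
theorem IsOperad.freeAlgebra_act_gen (hC : C.IsOperad) {k : ℕ} (x : P k) (f : Fin k → V) :
    (hC.freeAlgebra V).act x (fun j => Quotient.mk _ ⟨1, C.one, fun _ => f j⟩) =
      Quotient.mk _ ⟨k, x, f⟩ := by
  rw [hC.freeAlgebra_act_mk]
  congr 1
  refine freeOp_eq (by simp) (hC.comp_one _ x) fun j i => congrArg f ?_
  exact blocks_unit_right _ j i

/-! ### Words -/

/-- An operation with `n + len` inputs together with an assignment of elements of `X` to its last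
`len` inputs. -/
structure Word (P : ℕ → Type u) (X : Type u) (n : ℕ) : Type u where
  len : ℕ
  op : P (n + len)
  arg : Fin len → X

/-- The function of `n` variables that a word defines on an algebra. -/
def Word.eval {X : Type u} {n : ℕ} (w : Word P X n) (A : C.SetAlgebra) (φ : X → A.carrier)
    (v : Fin n → A.carrier) : A.carrier :=
  A.act w.op (Fin.append v (φ ∘ w.arg))

/-- Words which define the same functions on all algebras differ by a permutation of the last
inputs: in the free algebra on `Fin n ⊕ X` the two words are applied to the generators. -/
theorem IsOperad.exists_perm_of_eval_eq (hC : C.IsOperad) {n : ℕ} {X : Type u} {w w' : Word P X n}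
    (h : ∀ (A : C.SetAlgebra) (φ : X → A.carrier) (v : Fin n → A.carrier),
      w.eval A φ v = w'.eval A φ v) :
    ∃ (l : ℕ) (y : P (n + l)) (σ : Perm (Fin l)) (r : Fin l → X),
      w = ⟨l, C.act y (sumPerm 1 σ), r⟩ ∧ w' = ⟨l, y, r ∘ σ.symm⟩ := by
  obtain ⟨l, x, r⟩ := w
  obtain ⟨l', x', r'⟩ := w'
  let V := ULift.{u} (Fin n) ⊕ X
  let gen : V → (hC.freeAlgebra V).carrier := fun s => Quotient.mk _ ⟨1, C.one, fun _ => s⟩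
  have key := h (hC.freeAlgebra V) (fun s => gen (Sum.inr s)) (fun i => gen (Sum.inl ⟨i⟩))
  have hgen : ∀ {l : ℕ} (r : Fin l → X),
      Fin.append (fun i => gen (Sum.inl ⟨i⟩)) ((fun s => gen (Sum.inr s)) ∘ r) =
        fun i => gen (Fin.append (fun i => Sum.inl ⟨i⟩) (fun i => Sum.inr (r i)) i) := by
    intro l r
    funext i
    refine Fin.addCases (fun i => ?_) (fun i => ?_) i <;> simp
  unfold Word.eval at key
  rw [hgen, hgen] at key
  replace key := (hC.freeAlgebra_act_gen _ _).symm.trans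
    (key.trans (hC.freeAlgebra_act_gen _ _))
  replace key := Quotient.exact (s := hC.freeSetoid V) key
  obtain rfl : l = l' := by
    have := key.arity_eq
    dsimp only at this
    omega
  obtain ⟨τ, hx, hf⟩ := key.exists_perm
  dsimp only at hx hf
  -- The first `n` generators are distinct and differ from the others, so `τ` fixes them.
  have hτ : ∀ i, τ (Fin.castAdd l i) = Fin.castAdd l i := by
    intro i
    have := congrFun hf (τ (Fin.castAdd l i))
    rw [Function.comp_apply, Equiv.symm_apply_apply, Fin.append_left] at this
    revert this
    refine Fin.addCases (fun j => ?_) (fun j => ?_) (τ (Fin.castAdd l i))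
    · intro hj
      rw [Fin.append_left] at hj
      rw [show j = i from congrArg ULift.down (Sum.inl_injective hj)]
    · intro hj
      simp at hj
  obtain ⟨⟨σ₁, σ⟩, hσ⟩ := Perm.mem_sumCongrHom_range_of_perm_mapsTo_inl
    (σ := finSumFinEquiv.symm.permCongr τ) (by
      rintro _ ⟨i, rfl⟩
      refine ⟨i, ?_⟩
      simp [Equiv.permCongr_apply, hτ])
  obtain rfl : σ₁ = 1 := by
    ext1 i
    have := congrFun (congrArg DFunLike.coe hσ) (Sum.inl i)
    simpa [Equiv.permCongr_apply, hτ] using this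
  obtain rfl : τ = sumPerm 1 σ := by
    rw [sumPerm, ← Equiv.symm_apply_eq]
    exact hσ.symm
  refine ⟨l, x', σ, r, by rw [hx], ?_⟩
  congr 1
  funext i
  have := congrFun hf (Fin.natAdd n i)
  have hi : (sumPerm 1 σ).symm (Fin.natAdd n i) = Fin.natAdd n (σ.symm i) := by
    rw [Equiv.symm_apply_eq]
    simp [sumPerm, Equiv.permCongr_apply]
  rw [Function.comp_apply, hi, Fin.append_right, Fin.append_right] at this
  exact Sum.inr_injective this

/-- Operations which act in the same way on all algebras are equal: in the free algebra on `Fin n`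
they differ when applied to the distinct generators. -/
theorem IsOperad.eq_of_act_eq (hC : C.IsOperad) {n : ℕ} {x x' : P n}
    (h : ∀ (A : C.SetAlgebra) (v : Fin n → A.carrier), A.act x v = A.act x' v) : x = x' := by
  have key := h (hC.freeAlgebra (ULift.{u} (Fin n))) fun j => Quotient.mk _ ⟨1, C.one, fun _ => ⟨j⟩⟩
  rw [hC.freeAlgebra_act_gen, hC.freeAlgebra_act_gen] at key
  obtain ⟨σ, hx, hf⟩ := FreeRel.exists_perm (Quotient.exact (s := hC.freeSetoid _) key)
  have hσ : σ = 1 := by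
    ext i
    simpa using congrArg Fin.val (congrArg ULift.down (congrFun hf (σ i)))
  rw [hx, hσ, hC.act_one]

end OperadData

namespace OperadData

variable {P : ℕ → Type u} {X : Type u}

namespace Word

variable (C : OperadData P)

variable (X) in
/-- The unit, as a word. -/
def one : Word P X 1 := ⟨0, C.one, Fin.elim0⟩

/-- The action of `Σ_n` on words, through the first `n` inputs. -/
def act {n : ℕ} (w : Word P X n) (σ : Perm (Fin n)) : Word P X n :=
  ⟨w.len, C.act w.op (sumPerm σ 1), w.arg⟩

/-- Composition of words. -/
def comp {k m : ℕ} {n : Fin k → ℕ} (h : ∑ j, n j = m) (a : Word P X k)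
    (b : ∀ j, Word P X (n j)) : Word P X m :=
  ⟨a.len + ∑ j, (b j).len, C.compSplit h a.op fun j => (b j).op,
    Fin.append a.arg (concat fun j => (b j).arg)⟩

variable {C} (A : C.SetAlgebra) (φ : X → A.carrier)

theorem eval_one (v : Fin 1 → A.carrier) : (one X C).eval A φ v = v 0 := by
  refine (A.one_act _).trans ?_
  exact Fin.append_left v _ 0

theorem eval_act {n : ℕ} (w : Word P X n) (σ : Perm (Fin n)) (v : Fin n → A.carrier) :
    (w.act C σ).eval A φ v = w.eval A φ (v ∘ σ.symm) :=
  A.act_sumPerm w.op σ 1 v (φ ∘ w.arg)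

theorem comp_append_concat {Y : Type u} (f : X → Y) {k l : ℕ} {p : Fin k → ℕ} (r : Fin l → X)
    (s : ∀ j, Fin (p j) → X) :
    f ∘ Fin.append r (concat s) = Fin.append (f ∘ r) (concat fun j => f ∘ s j) := by
  funext i
  refine Fin.addCases (fun i => ?_) (fun i => ?_) i
  · simp
  · simp [concat]

theorem eval_comp {k m : ℕ} {n : Fin k → ℕ} (h : ∑ j, n j = m) (a : Word P X k)
    (b : ∀ j, Word P X (n j)) (v : Fin m → A.carrier) :
    (comp C h a b).eval A φ v =
      a.eval A φ fun j => (b j).eval A φ fun i => v (blocks h ⟨j, i⟩) := by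
  unfold eval comp
  dsimp only
  rw [comp_append_concat, A.act_compSplit]
  congr 1
  congr 1
  funext j
  congr 2
  funext i
  exact concat_blocks (fun j => φ ∘ (b j).arg) j i

end Word

end OperadData

/-! ### Reduction of words -/

namespace OperadAlgebra

open OperadData

variable {C : SimplicialOperad.{u}} {B : Type (u + 1)} [Category.{u} B] {FB : B → B → Type u}
  {CB : B → Type u} [∀ X Y, FunLike (FB X Y) (CB X) (CB Y)] [ConcreteCategory B FB]
  [TensorBase B] (R : OperadAlgebra C B)

/-- Words in the elements of `R` on the simplicial level `d`, which represent elements of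
`D_n ⊗_C R`. -/
abbrev Words (d : SimplexCategoryᵒᵖ) (n : ℕ) : Type u :=
  Word (fun n => (C.obj n).obj d) (ToType (R.obj.obj d)) n

variable {R} {d : SimplexCategoryᵒᵖ} {n : ℕ}

variable (R) in
/-- The class `[y; r]` of a word in `D_n ⊗_C R`. -/
def cls (w : R.Words d n) : ToType ((R.tensor n).obj d) := R.word w.op w.arg

/-- The word `w'` arises from `w` by permuting the last inputs and evaluating operations of `C` on
elements of `R`. The condition on the operations of the words is expressed through algebras in
sets. -/
def Reduces (w w' : R.Words d n) : Prop :=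
  ∃ (m : Fin w'.len → ℕ) (z : ∀ j, (C.obj (m j)).obj d)
    (t : ∀ j, Fin (m j) → ToType (R.obj.obj d)),
    (∀ (A : (C.data d).SetAlgebra) (φ : ToType (R.obj.obj d) → A.carrier) (v : Fin n → A.carrier),
      w.eval A φ v = A.act w'.op (Fin.append v fun j => A.act (z j) (φ ∘ t j))) ∧
    ∀ j, w'.arg j = R.act (z j) (t j)

theorem Reduces.of_eval_eq {w w' : R.Words d n}
    (h : ∀ (A : (C.data d).SetAlgebra) (φ : ToType (R.obj.obj d) → A.carrier)
      (v : Fin n → A.carrier), w.eval A φ v = w'.eval A φ v) : Reduces w w' :=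
  ⟨fun _ => 1, fun _ => (C.data d).one, fun j _ => w'.arg j, fun A φ v => by
    simp only [A.one_act]
    exact h A φ v, fun j => (R.one_act fun _ => w'.arg j).symm⟩

theorem Reduces.refl (w : R.Words d n) : Reduces w w := .of_eval_eq fun _ _ _ => rfl

theorem Reduces.graft {l : ℕ} {m : Fin l → ℕ} (y : (C.obj (n + l)).obj d)
    (z : ∀ j, (C.obj (m j)).obj d) (r : ∀ j, Fin (m j) → ToType (R.obj.obj d)) :
    Reduces (R := R) ⟨_, (C.data d).graft n y z, concat r⟩ ⟨l, y, fun j => R.act (z j) (r j)⟩ :=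
  ⟨m, z, r, fun A φ v => by
    refine (A.act_graft n y z v (φ ∘ concat r)).trans ?_
    congr 2
    funext j
    congr 1
    funext i
    exact congrArg φ (concat_blocks r j i), fun _ => rfl⟩

theorem Reduces.act {w w' : R.Words d n} (h : Reduces w w') (σ : Perm (Fin n)) :
    Reduces (w.act (C.data d) σ) (w'.act (C.data d) σ) := by
  obtain ⟨m, z, t, h, h'⟩ := h
  refine ⟨m, z, t, fun A φ v => ?_, h'⟩
  rw [Word.eval_act, h]
  exact (A.act_sumPerm w'.op σ 1 v fun j => A.act (z j) (φ ∘ t j)).symm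

/-- Reductions can be carried out inside a composite. This makes the composition of words descend
to `D_n ⊗_C R`, in all variables. -/
theorem Reduces.comp {k m : ℕ} {n : Fin k → ℕ} (h : ∑ j, n j = m) {a a' : R.Words d k}
    {b b' : ∀ j, R.Words d (n j)} (ha : Reduces a a') (hb : ∀ j, Reduces (b j) (b' j)) :
    Reduces (Word.comp (C.data d) h a b) (Word.comp (C.data d) h a' b') := by
  obtain ⟨p, z, t, ha, ha'⟩ := ha
  choose q w s hb hb' using hb
  -- The last inputs of the composite are those of `a'`, followed by those of the `b' j`.
  let e : Fin a'.len ⊕ (Slots fun j => (b' j).len) ≃ Fin (a'.len + ∑ j, (b' j).len) :=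
    (Equiv.sumCongr (Equiv.refl _) finSigmaFinEquiv).trans finSumFinEquiv
  let M : Fin a'.len ⊕ (Slots fun j => (b' j).len) → ℕ := Sum.elim p fun x => q x.1 x.2
  let Z : ∀ x, (C.obj (M x)).obj d := Sum.rec z fun x => w x.1 x.2
  let T : ∀ x, Fin (M x) → ToType (R.obj.obj d) := Sum.rec t fun x => s x.1 x.2
  refine ⟨fun i => M (e.symm i), fun i => Z (e.symm i), fun i => T (e.symm i), fun A φ v => ?_,
    fun i => ?_⟩
  · rw [Word.eval_comp, ha]
    simp only [hb]
    have hT : (fun i => A.act (Z (e.symm i)) (φ ∘ T (e.symm i))) =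
        Fin.append (fun j => A.act (z j) (φ ∘ t j))
          (concat fun j l => A.act (w j l) (φ ∘ s j l)) := by
      funext i
      change (fun x => A.act (Z x) (φ ∘ T x)) (e.symm i) = _
      obtain ⟨x, rfl⟩ := e.surjective i
      rw [Equiv.symm_apply_apply]
      rcases x with x | ⟨j, l⟩
      · exact (Fin.append_left (fun j => A.act (z j) (φ ∘ t j)) _ x).symm
      · exact ((Fin.append_right _ _ _).trans
          (concat_blocks (fun j l => A.act (w j l) (φ ∘ s j l)) j l)).symm
    refine Eq.trans ?_ (congrArg
      (fun f => A.act (Word.comp (C.data d) h a' b').op (Fin.append v f)) hT.symm)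
    refine Eq.trans ?_ (A.act_compSplit h a'.op (fun j => (b' j).op) v _ _).symm
    congr 2
    funext j
    congr 2
    funext l
    exact (concat_blocks (fun j l => A.act (w j l) (φ ∘ s j l)) j l).symm
  · change _ = (fun x => R.act (Z x) (T x)) (e.symm i)
    obtain ⟨x, rfl⟩ := e.surjective i
    rw [Equiv.symm_apply_apply]
    rcases x with x | ⟨j, l⟩
    · exact (Fin.append_left _ _ x).trans (ha' x)
    · exact (Fin.append_right _ _ _).trans ((concat_blocks (fun j => (b' j).arg) j l).trans
        (hb' j l))

/-- Words which define the same functions on all algebras are related by a permutation of the last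
inputs, and such words are identified already in `D_n R`. -/
theorem cls_eq_of_eval_eq {w w' : R.Words d n}
    (h : ∀ (A : (C.data d).SetAlgebra) (φ : ToType (R.obj.obj d) → A.carrier)
      (v : Fin n → A.carrier), w.eval A φ v = w'.eval A φ v) : R.cls w = R.cls w' := by
  obtain ⟨l, y, σ, r, rfl, rfl⟩ := (C.isOperad d).exists_perm_of_eval_eq h
  exact congrArg (TensorBase.proj _ (R.CoeqRel n d)) (DFunctor.word_act y σ r)

theorem Reduces.cls_eq {w w' : R.Words d n} (h : Reduces w w') : R.cls w = R.cls w' := by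
  obtain ⟨m, z, t, h, h'⟩ := h
  refine (cls_eq_of_eval_eq
    (w' := ⟨_, (C.data d).graft n w'.op z, concat t⟩) fun A φ v => ?_).trans
      ((R.word_graft w'.op z t).trans (congrArg (R.word w'.op) (funext h').symm))
  rw [h]
  refine Eq.trans ?_ (A.act_graft n w'.op z v (φ ∘ concat t)).symm
  congr 2
  funext j
  congr 1
  funext i
  exact (congrArg φ (concat_blocks t j i)).symm

end OperadAlgebra

/-! ### Generators -/

section

variable {B : Type (u + 1)} [Category.{u} B] {FB : B → B → Type u}
  {CB : B → Type u} [∀ X Y, FunLike (FB X Y) (CB X) (CB Y)] [ConcreteCategory B FB]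

/-- Morphisms out of `X` are determined by their values on the elements `w a`. -/
def Generates {X : B} {W : Type u} (w : W → ToType X) : Prop :=
  ∀ ⦃Y : B⦄ (f g : X ⟶ Y), (∀ a, f (w a) = g (w a)) → f = g

variable (B) in
/-- The properties of the ground category that make it possible to argue with generators: a
multimorphism is a function which is a morphism in each variable; multimorphisms can be defined on
generators, one variable at a time; and if the generators of `T` are distributed over a set `S`
compatibly with the relations between them, then `T` is the coproduct of fibres over `S`. -/
class TensorBase.Concrete [TensorBase B] : Prop where
  isMulti_iff {ι : Type} [DecidableEq ι] {X : ι → B} {Y : B}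
    {f : (∀ i, ToType (X i)) → ToType Y} :
    TensorBase.IsMulti X Y f ↔
      ∀ v i, ∃ L : X i ⟶ Y, ∀ x, L x = f (Function.update v i x)
  /-- A function `F` of generators extends to a multimorphism if, with all but one of the generators
  fixed, it extends to a morphism. -/
  exists_multi {ι : Type} [Finite ι] [DecidableEq ι] {X : ι → B} {Y : B} {W : ι → Type u}
    (w : ∀ i, W i → ToType (X i)) (hw : ∀ i, Generates (w i)) (F : (∀ i, W i) → ToType Y)
    (hF : ∀ v i, ∃ L : X i ⟶ Y, ∀ a, L (w i a) = F (Function.update v i a)) :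
    ∃ M, TensorBase.IsMulti X Y M ∧ ∀ v, M (fun i => w i (v i)) = F v
  exists_lift {X E T : B} {W : Type u} (w : W → ToType X) (hw : Generates w) (L : X ⟶ T)
    (m : E ⟶ T) (hm : Function.Injective m) (h : ∀ a, ∃ e, m e = L (w a)) :
    ∃ L' : X ⟶ E, ∀ x, m (L' x) = L x
  /-- The compatibility with the relations is the existence of the morphism `δ` to the coproduct of copies of `T`. -/
  exists_fibres {S W : Type u} {T : B} (w : W → ToType T) (hw : Generates w) (g : W → S)
    (δ : T ⟶ TensorBase.powers (fun _ : S => 1) T)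
    (hδ : ∀ a, δ (w a) = TensorBase.word (fun _ : S => 1) T (g a) fun _ => w a) :
    ∃ (E : S → B) (i : ∀ x, E x ⟶ T), Nonempty (IsColimit (Cofan.mk T i)) ∧
      ∀ a, ∃ e, i (g a) e = w a
  inj_injective {S : Type u} {E : S → B} {T : B} (i : ∀ x, E x ⟶ T)
    (hc : IsColimit (Cofan.mk T i)) (x : S) : Function.Injective (i x)
  fibre_generates {S W : Type u} {E : S → B} {T : B} (i : ∀ x, E x ⟶ T)
    (hc : IsColimit (Cofan.mk T i)) (w : W → ToType T) (hw : Generates w) (g : W → S)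
    (hg : ∀ a, ∃ e, i (g a) e = w a) (x : S) :
    Generates (fun e : {e // ∃ a, g a = x ∧ i x e = w a} => e.1)

end

/-- Generators of a set exhaust it: the two maps to `Prop` given by membership in their range and
by `True` agree. -/
theorem Generates.surjective {X : Type u} {W : Type u} {w : W → ToType X} (hw : Generates w) :
    Function.Surjective w := by
  intro x
  have := hw (Y := ULift.{u} Prop) (TypeCat.ofHom fun y => ⟨∃ a, w a = y⟩)
    (TypeCat.ofHom fun _ => ⟨True⟩) fun a => by simp
  have := congrArg ULift.down (ConcreteCategory.congr_hom this x)
  simpa using this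

/-- A function that is compatible with identifications in each variable is compatible with
simultaneous identifications. -/
theorem apply_eq_of_update {ι : Type*} [Finite ι] [DecidableEq ι] {W : ι → Type*} {X : ι → Type*}
    {Y : Type*} (w : ∀ i, W i → X i) (F : (∀ i, W i) → Y)
    (hF : ∀ v i a b, w i a = w i b → F (Function.update v i a) = F (Function.update v i b))
    (v v' : ∀ i, W i) (h : ∀ i, w i (v i) = w i (v' i)) : F v = F v' := by
  have := Fintype.ofFinite ι
  have key : ∀ s : Finset ι, F (s.piecewise v' v) = F v := by
    intro s
    induction s using Finset.induction_on with
    | empty => simp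
    | insert i s hi ih =>
      rw [Finset.piecewise_insert, ← ih, hF _ i (v' i) (v i) (h i).symm]
      congr 1
      funext j
      by_cases hj : j = i
      · subst hj
        simp [hi]
      · simp [hj]
  rw [← key Finset.univ, Finset.piecewise_univ]

instance TensorBase.Concrete.sets : TensorBase.Concrete.{u} (Type u) where
  isMulti_iff {ι _ X Y f} :=
    ⟨fun _ v i => ⟨TypeCat.ofHom fun x => f (Function.update v i x), fun _ => rfl⟩,
      fun _ => trivial⟩
  exists_multi {ι _ _ X Y W} w hw F hF := by
    choose s hs using fun i => (hw i).surjective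
    refine ⟨fun t => F fun i => s i (t i), trivial, fun v => ?_⟩
    refine apply_eq_of_update w F (fun v i a b hab => ?_) _ _ fun i => hs i _
    obtain ⟨L, hL⟩ := hF v i
    rw [← hL, ← hL, hab]
  exists_lift {X E T W} w hw L m hm h := by
    have : ∀ x, ∃ e, m e = L x := fun x => by
      obtain ⟨a, rfl⟩ := hw.surjective x
      exact h a
    choose f hf using this
    exact ⟨TypeCat.ofHom f, hf⟩
  exists_fibres {S W T} w hw g δ hδ := by
    refine ⟨fun x => {t : T // (δ t).1 = x}, fun x => TypeCat.ofHom Subtype.val,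
      ⟨Cofan.IsColimit.mk _ (fun s => TypeCat.ofHom fun t => s.inj (δ t).1 ⟨t, rfl⟩) ?_ ?_⟩, ?_⟩
    · rintro s x
      ext ⟨t, rfl⟩
      rfl
    · intro s m hm
      ext t
      exact ConcreteCategory.congr_hom (hm (δ t).1) ⟨t, rfl⟩
    · intro a
      exact ⟨⟨w a, by rw [hδ]; rfl⟩, rfl⟩
  inj_injective i hc x := Cofan.inj_injective_of_isColimit hc x
  fibre_generates {S W E T} i hc w hw g hg x := by
    intro Y f f' h
    ext e
    obtain ⟨a, ha⟩ := hw.surjective (i x e)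
    obtain ⟨e', he'⟩ := hg a
    exact h ⟨e, a, Cofan.eq_of_inj_apply_eq_of_isColimit hc e' e (he'.trans ha), ha.symm⟩

section

variable {K : Type u} [Field K]

/-- Generators of a module span it: the projection to the quotient by their span vanishes. -/
theorem Generates.span_eq_top {X : ModuleCat.{u} K} {W : Type u} {w : W → ToType X}
    (hw : Generates w) : Submodule.span K (Set.range w) = ⊤ := by
  have := hw (ModuleCat.ofHom (Submodule.mkQ (Submodule.span K (Set.range w)))) 0 fun a => by
    simpa using Submodule.subset_span (Set.mem_range_self a)
  rw [← Submodule.ker_mkQ (Submodule.span K (Set.range w)), LinearMap.ker_eq_top]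
  exact congrArg ModuleCat.Hom.hom this

open Classical in
/-- A coproduct of modules projects onto its summands. -/
theorem ModuleCat.exists_retraction {S : Type u} {E : S → ModuleCat.{u} K} {T : ModuleCat.{u} K}
    (i : ∀ x, E x ⟶ T) (hc : IsColimit (Cofan.mk T i)) (x : S) :
    ∃ p : T ⟶ E x, (∀ e, p (i x e) = e) ∧ ∀ y, y ≠ x → ∀ e, p (i y e) = 0 := by
  let c : Cofan E := Cofan.mk (E x) fun y => if h : y = x then eqToHom (congrArg E h) else 0
  have hp : ∀ y, i y ≫ hc.desc c = c.inj y := fun y => hc.fac c ⟨y⟩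
  refine ⟨hc.desc c, fun e => ?_, fun y hy e => ?_⟩
  · have := ConcreteCategory.congr_hom (hp x) e
    simpa [c] using this
  · have := ConcreteCategory.congr_hom (hp y) e
    simpa [c, hy] using this

/-- A function of spanning sets which extends linearly in each variable extends multilinearly. The
linear sections `s i` of the maps from free modules reduce this to the free case, but are not
compatible with the spanning elements, which is corrected one variable at a time. -/
theorem exists_multilinear {ι : Type} [Finite ι] [DecidableEq ι] {X : ι → ModuleCat.{u} K}
    {Y : ModuleCat.{u} K} {W : ι → Type u} (w : ∀ i, W i → X i)
    (hw : ∀ i, Submodule.span K (Set.range (w i)) = ⊤) (F : (∀ i, W i) → Y)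
    (hF : ∀ v i, ∃ L : X i →ₗ[K] Y, ∀ a, L (w i a) = F (Function.update v i a)) :
    ∃ M : MultilinearMap K (fun i => X i) Y, ∀ v, M (fun i => w i (v i)) = F v := by
  have := Fintype.ofFinite ι
  have hs : ∀ i, ∃ s : X i →ₗ[K] W i →₀ K, Finsupp.linearCombination K (w i) ∘ₗ s = .id := fun i =>
    LinearMap.exists_rightInverse_of_surjective _ (by rw [Finsupp.range_linearCombination, hw i])
  choose s hs using hs
  let G : MultilinearMap K (fun i => W i →₀ K) Y :=
    ((Basis.piTensorProduct fun i => Finsupp.basisSingleOne (R := K) (ι := W i)).constr K F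
      ).compMultilinearMap (PiTensorProduct.tprod K)
  have hG : ∀ v : ∀ i, W i, G (fun i => Finsupp.single (v i) 1) = F v := by
    intro v
    have := (Basis.piTensorProduct fun i => Finsupp.basisSingleOne (R := K) (ι := W i)).constr_basis
      K F v
    simpa [Basis.piTensorProduct_apply, G] using this
  refine ⟨G.compLinearMap s, fun v => ?_⟩
  -- Replace the canonical lifts `single (v i) 1` by the lifts `s i (w i (v i))`, one at a time.
  have key : ∀ (t : Finset ι) (v : ∀ i, W i), G (t.piecewise (fun i => s i (w i (v i)))
      (fun i => Finsupp.single (v i) 1)) = F v := by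
    intro t
    induction t using Finset.induction_on with
    | empty => simpa using hG
    | insert i t hi ih =>
      intro v
      rw [Finset.piecewise_insert]
      obtain ⟨L, hL⟩ := hF v i
      have hlin : G.toLinearMap (t.piecewise (fun i => s i (w i (v i)))
          (fun i => Finsupp.single (v i) 1)) i = L ∘ₗ Finsupp.linearCombination K (w i) := by
        ext a
        simp only [LinearMap.comp_apply, Finsupp.lsingle_apply, MultilinearMap.toLinearMap_apply,
          Finsupp.linearCombination_single, one_smul, hL, ← ih]
        congr 1
        funext j
        by_cases hj : j = i
        · subst hj
          simp [hi]
        · by_cases hjt : j ∈ t <;> simp [hj, hjt]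
      have := LinearMap.congr_fun hlin (s i (w i (v i)))
      rw [MultilinearMap.toLinearMap_apply] at this
      rw [this, LinearMap.comp_apply, ← LinearMap.comp_apply (Finsupp.linearCombination K (w i)),
        hs, LinearMap.id_apply, hL, Function.update_eq_self]
  simpa using key Finset.univ v

end

instance TensorBase.Concrete.modules (K : Type u) [Field K] :
    TensorBase.Concrete.{u} (ModuleCat.{u} K) where
  isMulti_iff {ι hι X Y f} := by
    constructor
    · rintro ⟨g, hg⟩ v i
      exact ⟨ModuleCat.ofHom (g.toLinearMap v i), fun x => hg _⟩
    · intro h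
      choose L hL using h
      refine ⟨⟨f, fun {inst} v i x y => ?_, fun {inst} v i c x => ?_⟩, fun _ => rfl⟩
      · obtain rfl := Subsingleton.elim inst hι
        simp only [← hL]
        exact map_add _ _ _
      · obtain rfl := Subsingleton.elim inst hι
        simp only [← hL]
        exact map_smul _ _ _
  exists_multi {ι _ _ X Y W} w hw F hF := by
    obtain ⟨M, hM⟩ := exists_multilinear w (fun i => (hw i).span_eq_top) F fun v i => by
      obtain ⟨L, hL⟩ := hF v i
      exact ⟨L.hom, hL⟩
    exact ⟨M, ⟨M, fun _ => rfl⟩, hM⟩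
  exists_lift {X E T W} w hw L m hm h := by
    have hr : LinearMap.range L.hom ≤ LinearMap.range m.hom := by
      rw [← Submodule.map_top, ← hw.span_eq_top, Submodule.map_span_le]
      rintro _ ⟨a, rfl⟩
      exact h a
    refine ⟨ModuleCat.ofHom ((LinearEquiv.ofInjective m.hom hm).symm.toLinearMap ∘ₗ
      L.hom.codRestrict _ fun x => hr ⟨x, rfl⟩), fun x => ?_⟩
    exact congrArg Subtype.val ((LinearEquiv.ofInjective m.hom hm).apply_symm_apply
      ⟨L.hom x, hr ⟨x, rfl⟩⟩)
  exists_fibres {S W T} w hw g δ hδ := by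
    classical
    have hone : ∀ {X Y : ModuleCat.{u} K} (L : X ⟶ Y),
        TensorBase.IsMulti (fun _ : Fin 1 => X) Y fun r => L (r 0) := fun L =>
      ⟨MultilinearMap.ofSubsingleton K _ _ (0 : Fin 1) L.hom, fun _ => rfl⟩
    -- The projection of `T` onto the span of the generators over `x`.
    obtain ⟨p, hp⟩ : ∃ p : S → (T ⟶ T), ∀ x a, p x (w a) = if g a = x then w a else 0 := by
      refine ⟨fun x => δ ≫ TensorBase.powersDesc
        (fun y r => (if y = x then 𝟙 T else 0 : T ⟶ T) (r 0)) fun y => hone _, fun x a => ?_⟩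
      rw [ConcreteCategory.comp_apply, hδ, TensorBase.powersDesc_word]
      split_ifs <;> rfl
    have hδp : ∀ x t, δ (p x t) = TensorBase.word (fun _ : S => 1) T x fun _ => p x t := by
      intro x
      obtain ⟨m, hm⟩ := TensorBase.word_isMulti (fun _ : S => 1) T x
      let ω : T ⟶ TensorBase.powers (fun _ : S => 1) T :=
        ModuleCat.ofHom ((MultilinearMap.ofSubsingleton K _ _ (0 : Fin 1)).symm m)
      have hω : ∀ t, ω t = TensorBase.word (fun _ : S => 1) T x fun _ => t := fun t => hm _
      have key : p x ≫ δ = p x ≫ ω := hw _ _ fun a => by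
        rw [ConcreteCategory.comp_apply, ConcreteCategory.comp_apply, hp, hω]
        split_ifs with h
        · rw [hδ, h]
        · rw [← hω, map_zero, map_zero]
      intro t
      rw [← hω]
      exact ConcreteCategory.congr_hom key t
    have hpp : ∀ x t, p x (p x t) = p x t := by
      intro x t
      have key : p x ≫ p x = p x := hw _ _ fun a => by
        rw [ConcreteCategory.comp_apply, hp]
        split_ifs with h
        · rw [hp, if_pos h]
        · rw [map_zero]
      exact ConcreteCategory.congr_hom key t
    let E : S → ModuleCat.{u} K := fun x => ModuleCat.of K (LinearMap.range (p x).hom)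
    let q : ∀ x, T ⟶ E x := fun x => ModuleCat.ofHom (p x).hom.rangeRestrict
    have hd : ∀ s : Cofan E, ∃ d : TensorBase.powers (fun _ : S => 1) T ⟶ s.pt, ∀ y r,
        d (TensorBase.word (fun _ : S => 1) T y r) = s.inj y (q y (r 0)) := fun s =>
      ⟨TensorBase.powersDesc (fun y r => (q y ≫ s.inj y) (r 0)) fun y => hone _,
        fun y r => TensorBase.powersDesc_word (X := T)
          (fun y r => (q y ≫ s.inj y) (r 0)) (fun y => hone _) y r⟩
    choose d hd using hd
    refine ⟨E, fun x => ModuleCat.ofHom (Submodule.subtype _),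
      ⟨Cofan.IsColimit.mk _ (fun s => δ ≫ d s) ?_ ?_⟩, ?_⟩
    · intro s x
      ext ⟨_, t, rfl⟩
      refine (congrArg (d s) (hδp x t)).trans ((hd s _ _).trans ?_)
      exact congrArg (s.inj x) (Subtype.ext (hpp x t))
    · intro s m hm
      refine hw _ _ fun a => ?_
      rw [ConcreteCategory.comp_apply, hδ, hd, ← hm, ConcreteCategory.comp_apply]
      have := hp (g a) a
      rw [if_pos rfl] at this
      exact congrArg m this.symm
    · intro a
      exact ⟨⟨w a, w a, by simpa using hp (g a) a⟩, rfl⟩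
  inj_injective i hc x := by
    obtain ⟨p, hp, -⟩ := ModuleCat.exists_retraction i hc x
    exact Function.LeftInverse.injective hp
  fibre_generates {S W E T} i hc w hw g hg x := by
    obtain ⟨p, hp, hp'⟩ := ModuleCat.exists_retraction i hc x
    intro Y f f' h
    have key : p ≫ f = p ≫ f' := by
      refine hw _ _ fun a => ?_
      obtain ⟨e, he⟩ := hg a
      rw [ConcreteCategory.comp_apply, ConcreteCategory.comp_apply, ← he]
      by_cases ha : g a = x
      · subst ha
        rw [hp]
        exact h ⟨e, a, rfl, he⟩
      · rw [hp' _ ha, map_zero, map_zero]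
    ext e
    have := ConcreteCategory.congr_hom key (i x e)
    rwa [ConcreteCategory.comp_apply, ConcreteCategory.comp_apply, hp] at this

/-! ### Morphisms on elements -/

section

variable {B : Type (u + 1)} [Category.{u} B] {FB : B → B → Type u}
  {CB : B → Type u} [∀ X Y, FunLike (FB X Y) (CB X) (CB Y)] [ConcreteCategory B FB]

/-- The function `f` is a morphism. -/
def IsHom {X Y : B} (f : ToType X → ToType Y) : Prop := ∃ L : X ⟶ Y, ∀ x, L x = f x

theorem isHom_apply {X Y : B} (L : X ⟶ Y) : IsHom (fun x => L x) := ⟨L, fun _ => rfl⟩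

theorem isHom_id (X : B) : IsHom fun x : ToType X => x := ⟨𝟙 X, fun x => by simp⟩

theorem IsHom.comp {X Y Z : B} {g : ToType Y → ToType Z} {f : ToType X → ToType Y} (hg : IsHom g)
    (hf : IsHom f) : IsHom fun x => g (f x) := by
  obtain ⟨L, hL⟩ := hf
  obtain ⟨M, hM⟩ := hg
  exact ⟨L ≫ M, fun x => by rw [ConcreteCategory.comp_apply, hL, hM]⟩

theorem Generates.eq_of_isHom {X Y : B} {W : Type u} {w : W → ToType X} (hw : Generates w)
    {f g : ToType X → ToType Y} (hf : IsHom f) (hg : IsHom g) (h : ∀ a, f (w a) = g (w a))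
    (x : ToType X) : f x = g x := by
  obtain ⟨L, hL⟩ := hf
  obtain ⟨M, hM⟩ := hg
  rw [← hL, ← hM, hw L M fun a => by rw [hL, hM, h]]

theorem generates_id (X : B) : Generates fun x : ToType X => x := fun _ _ _ h =>
  ConcreteCategory.hom_ext _ _ h

/-- Two functions which are morphisms in each variable agree if they agree on generators. -/
theorem eq_of_generates {ι : Type} [Finite ι] [DecidableEq ι] {X : ι → B} {Y : B} {W : ι → Type u}
    {w : ∀ i, W i → ToType (X i)} (hw : ∀ i, Generates (w i))
    {f g : (∀ i, ToType (X i)) → ToType Y}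
    (hf : ∀ v i, IsHom fun x => f (Function.update v i x))
    (hg : ∀ v i, IsHom fun x => g (Function.update v i x))
    (h : ∀ v : ∀ i, W i, f (fun i => w i (v i)) = g (fun i => w i (v i)))
    (v : ∀ i, ToType (X i)) : f v = g v := by
  have := Fintype.ofFinite ι
  -- Induction on the number of variables which need not be generators.
  have key : ∀ (s : Finset ι) (v : ∀ i, ToType (X i)),
      (∀ i ∉ s, v i ∈ Set.range (w i)) → f v = g v := by
    intro s
    induction s using Finset.induction_on with
    | empty =>
      intro v hv
      choose a ha using fun i => hv i (Finset.notMem_empty i)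
      obtain rfl : (fun i => w i (a i)) = v := funext ha
      exact h a
    | insert i s hi ih =>
      intro v hv
      have := (hw i).eq_of_isHom (hf v i) (hg v i) (fun a => ih _ fun j hj => ?_) (v i)
      · simpa using this
      · by_cases hji : j = i
        · subst hji
          exact ⟨a, by simp⟩
        · rw [Function.update_of_ne hji]
          exact hv j (by simp [hji, hj])
  exact key Finset.univ v fun i hi => absurd (Finset.mem_univ i) hi

variable [TensorBase B] [TensorBase.Concrete B]

theorem isMulti_iff_isHom {ι : Type} [DecidableEq ι] {X : ι → B} {Y : B}
    {f : (∀ i, ToType (X i)) → ToType Y} :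
    TensorBase.IsMulti X Y f ↔ ∀ v i, IsHom fun x => f (Function.update v i x) :=
  TensorBase.Concrete.isMulti_iff

theorem isHom_of_isMulti_single {X Y : B} {f : (Fin 1 → ToType X) → ToType Y}
    (hf : TensorBase.IsMulti (fun _ : Fin 1 => X) Y f) (x : ToType X) :
    IsHom fun t : ToType X => f fun _ => t := by
  have := isMulti_iff_isHom.1 hf (fun _ => x) 0
  convert! this using 3 with t
  funext i
  rw [Subsingleton.elim i 0, Function.update_self]

/-- A multimorphism whose values on generators lie in a subobject factors through it. -/
theorem exists_of_generates {ι : Type} [Finite ι] [DecidableEq ι] {X : ι → B} {E T : B}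
    {W : ι → Type u} {w : ∀ i, W i → ToType (X i)} (hw : ∀ i, Generates (w i)) (m : E ⟶ T)
    (hm : Function.Injective m) {f : (∀ i, ToType (X i)) → ToType T}
    (hf : ∀ v i, IsHom fun x => f (Function.update v i x))
    (h : ∀ v : ∀ i, W i, ∃ e, m e = f (fun i => w i (v i))) (v : ∀ i, ToType (X i)) :
    ∃ e, m e = f v := by
  have := Fintype.ofFinite ι
  -- Induction on the number of variables which need not be generators.
  have key : ∀ (s : Finset ι) (v : ∀ i, ToType (X i)),
      (∀ i ∉ s, v i ∈ Set.range (w i)) → ∃ e, m e = f v := by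
    intro s
    induction s using Finset.induction_on with
    | empty =>
      intro v hv
      choose a ha using fun i => hv i (Finset.notMem_empty i)
      obtain rfl : (fun i => w i (a i)) = v := funext ha
      exact h a
    | insert i s hi ih =>
      intro v hv
      obtain ⟨L, hL⟩ := hf v i
      obtain ⟨L', hL'⟩ := ‹TensorBase.Concrete B›.exists_lift (w i) (hw i) L m hm fun a => by
        rw [hL]
        refine ih _ fun j hj => ?_
        by_cases hji : j = i
        · subst hji
          exact ⟨a, by simp⟩
        · rw [Function.update_of_ne hji]
          exact hv j (by simp [hji, hj])
      exact ⟨L' (v i), by simp [hL', hL]⟩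
  exact key Finset.univ v fun i hi => absurd (Finset.mem_univ i) hi

/-- A function to a subobject is a morphism if it is one as a function to the ambient object. -/
theorem IsHom.of_comp {X E T : B} {m : E ⟶ T} (hm : Function.Injective m)
    {f : ToType X → ToType E} (h : IsHom fun x => m (f x)) : IsHom f := by
  obtain ⟨L, hL⟩ := h
  obtain ⟨L', hL'⟩ := ‹TensorBase.Concrete B›.exists_lift _ (generates_id X) L m hm fun x =>
    ⟨f x, (hL x).symm⟩
  exact ⟨L', fun x => hm (by rw [hL', hL])⟩

end

namespace OperadAlgebra

open OperadData

variable {C : SimplicialOperad.{u}} {B : Type (u + 1)} [Category.{u} B] {FB : B → B → Type u}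
  {CB : B → Type u} [∀ X Y, FunLike (FB X Y) (CB X) (CB Y)] [ConcreteCategory B FB]
  [TensorBase B] (R : OperadAlgebra C B)

theorem generates_cls (d : SimplexCategoryᵒᵖ) (n : ℕ) :
    Generates (X := (R.tensor n).obj d) (R.cls (d := d) (n := n)) := fun _ _ _ h =>
  R.tensor_ext fun y r => h ⟨_, y, r⟩

/-- Morphisms out of `D_n ⊗_C R`: functions of words which are multimorphisms for each operation
and are compatible with reductions. -/
theorem exists_desc {d : SimplexCategoryᵒᵖ} {n : ℕ} {Y : B} (G : R.Words d n → ToType Y)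
    (hG : ∀ {l : ℕ} (y : (C.obj (n + l)).obj d),
      TensorBase.IsMulti (fun _ : Fin l => R.obj.obj d) Y fun r => G ⟨l, y, r⟩)
    (hr : ∀ {w w'}, Reduces w w' → G w = G w') :
    ∃ L : (R.tensor n).obj d ⟶ Y, ∀ w, L (R.cls w) = G w := by
  have h₁ : ∀ v w, DFunctor.OrbitRel C n d (R.obj.obj d) v w → TensorBase.powersDesc
      (T := Σ l, (C.obj (n + l)).obj d) (fun t r => G ⟨t.1, t.2, r⟩) (fun t => hG t.2) v =
      TensorBase.powersDesc (T := Σ l, (C.obj (n + l)).obj d)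
        (fun t r => G ⟨t.1, t.2, r⟩) (fun t => hG t.2) w := by
    rintro _ _ ⟨y, σ, r⟩
    unfold DFunctor.preWord
    rw [TensorBase.powersDesc_word, TensorBase.powersDesc_word]
    exact hr (.of_eval_eq fun A φ v => A.act_sumPerm y 1 σ v (φ ∘ r))
  have hword : ∀ w : R.Words d n, TensorBase.quotDesc _ h₁ (DFunctor.word C w.op w.arg) = G w := by
    intro w
    refine (TensorBase.quotDesc_proj _ h₁ _).trans ?_
    exact TensorBase.powersDesc_word _ _ _ _
  refine ⟨TensorBase.quotDesc (TensorBase.quotDesc _ h₁) ?_, fun w => ?_⟩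
  · rintro _ _ ⟨y, z, r⟩
    rw [hword ⟨_, _, _⟩, hword ⟨_, _, _⟩]
    exact hr (.graft y z r)
  · exact (TensorBase.quotDesc_proj _ _ _).trans (hword w)

end OperadAlgebra

/-! ### Multimorphisms and concatenation -/

theorem append_update_left {X : Type*} {l m : ℕ} (r : Fin l → X) (s : Fin m → X) (i : Fin l)
    (x : X) : Fin.append (Function.update r i x) s =
      Function.update (Fin.append r s) (Fin.castAdd m i) x := by
  funext j
  refine Fin.addCases (fun j => ?_) (fun j => ?_) j
  · by_cases hj : j = i
    · subst hj
      simp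
    · simp [hj]
  · rw [Fin.append_right, Function.update_of_ne, Fin.append_right]
    simp [Fin.ext_iff]
    omega

theorem append_update_right {X : Type*} {l m : ℕ} (r : Fin l → X) (s : Fin m → X) (i : Fin m)
    (x : X) : Fin.append r (Function.update s i x) =
      Function.update (Fin.append r s) (Fin.natAdd l i) x := by
  funext j
  refine Fin.addCases (fun j => ?_) (fun j => ?_) j
  · rw [Fin.append_left, Function.update_of_ne, Fin.append_left]
    simp [Fin.ext_iff]
    omega
  · by_cases hj : j = i
    · subst hj
      simp
    · simp [hj]

theorem concat_update {X : Type u} {k : ℕ} {n : Fin k → ℕ} (r : ∀ j, Fin (n j) → X) (j : Fin k)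
    (i : Fin (n j)) (x : X) : concat (Function.update r j (Function.update (r j) i x)) =
      Function.update (concat r) (finSigmaFinEquiv ⟨j, i⟩) x := by
  funext q
  obtain ⟨⟨j', i'⟩, rfl⟩ := finSigmaFinEquiv.surjective q
  rw [concat_blocks]
  by_cases hj : j' = j
  · subst hj
    rw [Function.update_self]
    by_cases hi : i' = i
    · subst hi
      simp
    · rw [Function.update_of_ne hi, Function.update_of_ne, concat_blocks]
      simpa using hi
  · rw [Function.update_of_ne hj, Function.update_of_ne, concat_blocks]
    intro h
    exact hj (congrArg Sigma.fst (finSigmaFinEquiv.injective h))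

/-- The family on `Option κ` with the value `t` at `none` and the values `s j` at `some j`. -/
abbrev optionPair {κ : Type*} {β : Option κ → Type*} (t : β none) (s : ∀ j, β (some j))
    (o : Option κ) : β o :=
  Option.rec (motive := β) t s o

theorem update_optionPair_none {κ : Type*} [DecidableEq κ] {β : Option κ → Type*} (t : β none)
    (s : ∀ j, β (some j)) (x : β none) :
    Function.update (optionPair t s) none x = optionPair x s := by
  funext o
  cases o <;> simp

theorem update_optionPair_some {κ : Type*} [DecidableEq κ] {β : Option κ → Type*} (t : β none)
    (s : ∀ j, β (some j)) (j : κ) (x : β (some j)) :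
    Function.update (optionPair t s) (some j) x = optionPair t (Function.update s j x) := by
  funext o
  rcases o with _ | j'
  · simp
  · by_cases hj : j' = j
    · subst hj
      simp
    · simp [hj]

/-- Functions of a variable and a family of variables which are multimorphisms are those which are
morphisms in each variable. (The idle quantifier is over the value of the first variable that is
replaced by `t`.) -/
theorem isMulti_elim_iff {B : Type (u + 1)} [Category.{u} B] {FB : B → B → Type u}
    {CB : B → Type u} [∀ X Y, FunLike (FB X Y) (CB X) (CB Y)] [ConcreteCategory B FB]
    [TensorBase B] [TensorBase.Concrete B] {k : ℕ} {X Z : B} {Y : Fin k → B}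
    {f : ToType X → (∀ j, ToType (Y j)) → ToType Z} :
    TensorBase.IsMulti (fun o : Option (Fin k) => (o.elim X Y : B)) Z
        (fun v => f (v none) fun j => v (some j)) ↔
      (∀ (_ : ToType X) s, IsHom fun t => f t s) ∧
        ∀ t s j, IsHom fun x => f t (Function.update s j x) := by
  rw [isMulti_iff_isHom]
  constructor
  · intro h
    refine ⟨fun t s => ?_, fun t s j => ?_⟩
    · obtain ⟨L, hL⟩ := h
        (optionPair (β := fun o : Option (Fin k) => ToType (o.elim X Y : B)) t s) none
      exact ⟨L, fun x => (hL x).trans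
        (congrArg (fun v : ∀ o : Option (Fin k), ToType (o.elim X Y : B) =>
          f (v none) fun j => v (some j)) (update_optionPair_none t s x))⟩
    · obtain ⟨L, hL⟩ := h
        (optionPair (β := fun o : Option (Fin k) => ToType (o.elim X Y : B)) t s) (some j)
      exact ⟨L, fun x => (hL x).trans
        (congrArg (fun v : ∀ o : Option (Fin k), ToType (o.elim X Y : B) =>
          f (v none) fun j => v (some j)) (update_optionPair_some t s j x))⟩
  · rintro ⟨hl, hr⟩ v o
    rcases o with _ | j
    · obtain ⟨L, hL⟩ := hl (v none) fun j => v (some j)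
      refine ⟨L, fun x => (hL x).trans ?_⟩
      simp
    · obtain ⟨L, hL⟩ := hr (v none) (fun j => v (some j)) j
      refine ⟨L, fun x => (hL x).trans (congrArg (f _) ?_)⟩
      exact (Function.update_comp_eq_of_injective' v (Option.some_injective _) j x).symm

/-! ### The operad of the objects `D_n ⊗_C R` -/

namespace OperadAlgebra

open OperadData

variable {C : SimplicialOperad.{u}} {B : Type (u + 1)} [Category.{u} B] {FB : B → B → Type u}
  {CB : B → Type u} [∀ X Y, FunLike (FB X Y) (CB X) (CB Y)] [ConcreteCategory B FB]
  [TensorBase B] [TensorBase.Concrete B] (R : OperadAlgebra C B) {d : SimplexCategoryᵒᵖ}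

theorem cls_isHom {n l : ℕ} (y : (C.obj (n + l)).obj d) (r : Fin l → ToType (R.obj.obj d))
    (i : Fin l) : IsHom (X := R.obj.obj d) (Y := (R.tensor n).obj d)
      fun x => R.cls ⟨l, y, Function.update r i x⟩ :=
  isMulti_iff_isHom.1 (TensorBase.postcomp (DFunctor.word_isMulti y)
    (TensorBase.proj _ (R.CoeqRel n d))) r i

section

variable {k m : ℕ} {n : Fin k → ℕ} (h : ∑ j, n j = m)

theorem cls_comp_isHom_left (a : R.Words d k) (b : ∀ j, R.Words d (n j)) (i : Fin a.len) :
    IsHom (X := R.obj.obj d) (Y := (R.tensor m).obj d) fun x =>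
      R.cls (Word.comp (C.data d) h ⟨a.len, a.op, Function.update a.arg i x⟩ b) := by
  unfold Word.comp
  dsimp only
  simp only [append_update_left]
  exact R.cls_isHom _ _ _

/-- The word `b j` is called `w` so that the lemma applies to a family `b` defined by its values. -/
theorem cls_comp_isHom_right (a : R.Words d k) (b : ∀ j, R.Words d (n j)) (j : Fin k) :
    ∀ w : R.Words d (n j), b j = w → ∀ i : Fin w.len,
      IsHom (X := R.obj.obj d) (Y := (R.tensor m).obj d) fun x =>
        R.cls (Word.comp (C.data d) h a
          (Function.update b j ⟨w.len, w.op, Function.update w.arg i x⟩)) := by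
  rintro _ rfl i
  have key : ∀ x, Function.update b j ⟨(b j).len, (b j).op, Function.update (b j).arg i x⟩ =
      fun j' => ⟨(b j').len, (b j').op, Function.update (fun j' => (b j').arg) j
        (Function.update (b j).arg i x) j'⟩ := by
    intro x
    funext j'
    by_cases hj : j' = j
    · subst hj
      simp
    · simp [hj]
  simp only [key]
  unfold Word.comp
  dsimp only
  simp only [concat_update (fun j' => (b j').arg), append_update_right]
  exact R.cls_isHom _ _ _

/-- The objects `D_k ⊗_C R` and `D_{n j} ⊗_C R` whose elements can be composed. -/
abbrev compSource (R : OperadAlgebra C B) (d : SimplexCategoryᵒᵖ) (k : ℕ) (n : Fin k → ℕ)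
    (o : Option (Fin k)) : B :=
  (R.tensor (o.elim k n)).obj d

/-- The composition of classes of words extends to a multimorphism: in each variable it is a
multimorphism of the elements of `R` in the word, and it is compatible with reductions. -/
theorem exists_comp : ∃ M : (∀ o, ToType (compSource R d k n o)) → ToType ((R.tensor m).obj d),
    TensorBase.IsMulti (compSource R d k n) ((R.tensor m).obj d) M ∧
    ∀ (v : ∀ o : Option (Fin k), R.Words d (o.elim k n)), M (fun o => R.cls (v o)) =
      R.cls (Word.comp (k := k) (n := n) (C.data d) h (v none) fun j => v (some j)) := by
  classical
  refine ‹TensorBase.Concrete B›.exists_multi (W := fun o => R.Words d (o.elim k n))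
    (fun o => R.cls) (fun o => R.generates_cls d _) (fun v =>
      R.cls (Word.comp (k := k) (n := n) (C.data d) h (v none) fun j => v (some j))) fun v o => ?_
  rcases o with _ | j
  · simp only [Function.update_self, ne_eq, reduceCtorEq, not_false_eq_true, Function.update_of_ne]
    refine R.exists_desc (fun a => R.cls (Word.comp (C.data d) h a fun j => v (some j)))
      (fun y => ?_) fun hw => (hw.comp h fun _ => .refl _).cls_eq
    rw [isMulti_iff_isHom]
    intro r i
    exact R.cls_comp_isHom_left h ⟨_, y, r⟩ _ i
  -- In the variable `j`, the other variables are kept as a family `b` on `Fin k`.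
  · obtain ⟨b, hb⟩ : ∃ b : ∀ j, R.Words d (n j), b = fun j => v (some j) := ⟨_, rfl⟩
    have key : ∀ w : R.Words d (n j), (fun j' => Function.update v (some j) w (some j')) =
        Function.update b j w := fun w =>
      (Function.update_comp_eq_of_injective' v (Option.some_injective _) j w).trans
        (by rw [hb]; rfl)
    suffices hs : ∃ L : (R.tensor (n j)).obj d ⟶ (R.tensor m).obj d, ∀ w, L (R.cls w) =
        R.cls (Word.comp (C.data d) h (v none) (Function.update b j w)) by
      obtain ⟨L, hL⟩ := hs
      exact ⟨L, fun w => (hL w).trans (congrArg₂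
        (fun a b => R.cls (Word.comp (k := k) (n := n) (C.data d) h a b))
        (Function.update_of_ne (by simp) _ _).symm (key w).symm)⟩
    refine R.exists_desc (n := n j) (fun w => R.cls (Word.comp (C.data d) h (v none)
      (Function.update b j w))) (fun y => ?_) fun hw =>
        ((Reduces.refl _).comp h fun j' => ?_).cls_eq
    · rw [isMulti_iff_isHom]
      intro r i
      simpa using R.cls_comp_isHom_right h (v none) (Function.update b j ⟨_, y, r⟩) j ⟨_, y, r⟩
        (by simp) i
    · by_cases hj : j' = j
      · subst hj
        simpa using hw
      · simpa [hj] using Reduces.refl _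

end

theorem exists_act (n : ℕ) (σ : Perm (Fin n)) :
    ∃ L : (R.tensor n).obj d ⟶ (R.tensor n).obj d,
      ∀ w, L (R.cls w) = R.cls (w.act (C.data d) σ) := by
  refine R.exists_desc _ (fun y => ?_) fun hw => (hw.act σ).cls_eq
  rw [isMulti_iff_isHom]
  intro r i
  exact R.cls_isHom ((C.data d).act y (sumPerm σ 1)) r i

variable (d) in
/-- The operad structure on the elements of the objects `D_n ⊗_C R` on the simplicial level `d`,
without the fibration over `C`. -/
noncomputable def tensorOperad : OperadData fun n => ToType ((R.tensor n).obj d) where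
  one := R.cls (Word.one _ (C.data d))
  act {n} t σ := (R.exists_act n σ).choose t
  comp {k _ n} h t s := (R.exists_comp (d := d) h).choose fun o =>
    optionPair (β := fun o => ToType (compSource R d k n o)) t s o

theorem tensorOperad_act_cls {n : ℕ} (w : R.Words d n) (σ : Perm (Fin n)) :
    (R.tensorOperad d).act (R.cls w) σ = R.cls (w.act (C.data d) σ) :=
  (R.exists_act n σ).choose_spec w

theorem tensorOperad_act_isHom {n : ℕ} (σ : Perm (Fin n)) :
    IsHom (X := (R.tensor n).obj d) (Y := (R.tensor n).obj d)
      fun t => (R.tensorOperad d).act t σ := isHom_apply _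

section

variable {k m : ℕ} {n : Fin k → ℕ} (h : ∑ j, n j = m)

theorem tensorOperad_comp_cls (a : R.Words d k) (b : ∀ j, R.Words d (n j)) :
    (R.tensorOperad d).comp h (R.cls a) (fun j => R.cls (b j)) =
      R.cls (Word.comp (C.data d) h a b) := by
  refine Eq.trans ?_ ((R.exists_comp (d := d) h).choose_spec.2
    (optionPair (β := fun o : Option (Fin k) => R.Words d (o.elim k n)) a b))
  refine congrArg (R.exists_comp (d := d) h).choose (funext fun o => ?_)
  cases o <;> rfl

/-- The element `t` is only a value at which the first variable is placed. -/
theorem tensorOperad_comp_isHom_left (t : ToType ((R.tensor k).obj d))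
    (s : ∀ j, ToType ((R.tensor (n j)).obj d)) :
    IsHom (X := (R.tensor k).obj d) (Y := (R.tensor m).obj d)
      fun x => (R.tensorOperad d).comp h x s := by
  obtain ⟨L, hL⟩ := isMulti_iff_isHom.1 (R.exists_comp (d := d) h).choose_spec.1
    (optionPair (β := fun o => ToType (compSource R d k n o)) t s) none
  exact ⟨L, fun x => (hL x).trans (congrArg _ (update_optionPair_none _ _ _))⟩

theorem tensorOperad_comp_isHom_right (t : ToType ((R.tensor k).obj d))
    (s : ∀ j, ToType ((R.tensor (n j)).obj d)) (j : Fin k) :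
    IsHom (X := (R.tensor (n j)).obj d) (Y := (R.tensor m).obj d)
      fun x => (R.tensorOperad d).comp h t (Function.update s j x) := by
  obtain ⟨L, hL⟩ := isMulti_iff_isHom.1 (R.exists_comp (d := d) h).choose_spec.1
    (optionPair (β := fun o => ToType (compSource R d k n o)) t s) (some j)
  exact ⟨L, fun x => (hL x).trans (congrArg _ (update_optionPair_some _ _ _ _))⟩

end

end OperadAlgebra

namespace OperadAlgebra

open OperadData

variable {C : SimplicialOperad.{u}} {B : Type (u + 1)} [Category.{u} B] {FB : B → B → Type u}
  {CB : B → Type u} [∀ X Y, FunLike (FB X Y) (CB X) (CB Y)] [ConcreteCategory B FB]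
  [TensorBase B] [TensorBase.Concrete B] (R : OperadAlgebra C B) (d : SimplexCategoryᵒᵖ)

/-- Each axiom is an equation between functions which are morphisms in each variable, so that it
suffices to check it on classes of words; there it holds because both sides define the same
functions on algebras. -/
theorem tensorOperad_isOperad : (R.tensorOperad d).IsOperad where
  act_one := by
    intro n x
    refine (R.generates_cls d n).eq_of_isHom (R.tensorOperad_act_isHom 1) (isHom_id _)
      (fun w => ?_) x
    rw [tensorOperad_act_cls]
    exact cls_eq_of_eval_eq fun A φ v => Word.eval_act A φ w 1 v
  act_mul := by
    intro n x σ τ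
    refine (R.generates_cls d n).eq_of_isHom (R.tensorOperad_act_isHom _)
      ((R.tensorOperad_act_isHom τ).comp (R.tensorOperad_act_isHom σ)) (fun w => ?_) x
    rw [tensorOperad_act_cls, tensorOperad_act_cls, tensorOperad_act_cls]
    refine cls_eq_of_eval_eq fun A φ v => ?_
    rw [Word.eval_act, Word.eval_act, Word.eval_act]
    rfl
  one_comp := by
    intro n h x
    refine (R.generates_cls d n).eq_of_isHom
      (f := fun x => (R.tensorOperad d).comp h (R.tensorOperad d).one fun _ => x) ?_ (isHom_id _)
      (fun w => ?_) x
    · have := R.tensorOperad_comp_isHom_right h (R.tensorOperad d).one (fun _ => x) 0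
      convert! this using 3 with y
      funext j
      rw [Subsingleton.elim j 0, Function.update_self]
    · refine (R.tensorOperad_comp_cls h _ _).trans (cls_eq_of_eval_eq fun A φ v => ?_)
      rw [Word.eval_comp, Word.eval_one]
      simp only [blocks_unit_left]
  comp_one := by
    intro n h x
    refine (R.generates_cls d n).eq_of_isHom (R.tensorOperad_comp_isHom_left h x _) (isHom_id _)
      (fun w => ?_) x
    refine (R.tensorOperad_comp_cls h _ _).trans (cls_eq_of_eval_eq fun A φ v => ?_)
    rw [Word.eval_comp]
    simp only [Word.eval_one, blocks_unit_right]
  assoc := by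
    intro k m N n p h h₁ h₂ x y z
    refine (R.generates_cls d k).eq_of_isHom
      ((R.tensorOperad_comp_isHom_left h₁ ((R.tensorOperad d).comp h x y) _).comp
        (R.tensorOperad_comp_isHom_left h x y))
      (R.tensorOperad_comp_isHom_left h₂ x _) (fun a => ?_) x
    refine eq_of_generates (Y := (R.tensor N).obj d) (fun j => R.generates_cls d (n j))
      (f := fun y => (R.tensorOperad d).comp h₁ ((R.tensorOperad d).comp h (R.cls a) y)
        fun i => z ((blocks h).symm i).1 ((blocks h).symm i).2)
      (g := fun y => (R.tensorOperad d).comp h₂ (R.cls a)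
        fun j => (R.tensorOperad d).comp rfl (y j) (z j))
      (fun y j => ?_) (fun y j => ?_) (fun b => ?_) y
    · exact (R.tensorOperad_comp_isHom_left h₁ ((R.tensorOperad d).comp h (R.cls a) y) _).comp
        (R.tensorOperad_comp_isHom_right h _ y j)
    · simp only [Function.apply_update fun j t => (R.tensorOperad d).comp rfl t (z j)]
      exact (R.tensorOperad_comp_isHom_right h₂ _ _ j).comp
        (R.tensorOperad_comp_isHom_left rfl (y j) (z j))
    dsimp only
    -- The innermost variables `z j l` are treated as one family, indexed by the slots.
    refine eq_of_generates (Y := (R.tensor N).obj d) (ι := Slots n)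
      (fun s => R.generates_cls d (p s.1 s.2))
      (f := fun z => (R.tensorOperad d).comp h₁ ((R.tensorOperad d).comp h (R.cls a) _)
        fun i => z ((blocks h).symm i))
      (g := fun z => (R.tensorOperad d).comp h₂ (R.cls a)
        fun j => (R.tensorOperad d).comp rfl (R.cls (b j)) fun l => z ⟨j, l⟩)
      (fun z s => ?_) (fun z s => ?_) (fun c => ?_) (fun s => z s.1 s.2)
    · obtain ⟨i, rfl⟩ := (blocks h).symm.surjective s
      simp only [Function.update_comp_eq_of_injective' z (blocks h).symm.injective]
      exact R.tensorOperad_comp_isHom_right h₁ _ _ i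
    · obtain ⟨j, l⟩ := s
      have key : ∀ t, (fun j' => (R.tensorOperad d).comp rfl (R.cls (b j')) fun l' =>
          Function.update z ⟨j, l⟩ t ⟨j', l'⟩) = Function.update
            (fun j' => (R.tensorOperad d).comp rfl (R.cls (b j')) fun l' => z ⟨j', l'⟩) j
            ((R.tensorOperad d).comp rfl (R.cls (b j))
              (Function.update (fun l' => z ⟨j, l'⟩) l t)) := by
        intro t
        funext j'
        by_cases hj : j' = j
        · subst hj
          rw [Function.update_self]
          congr 1
          exact Function.update_comp_eq_of_injective' z sigma_mk_injective l t
        · rw [Function.update_of_ne hj]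
          congr 1
          funext l'
          exact Function.update_of_ne (fun h => hj (congrArg Sigma.fst h)) _ _
      simp only [key]
      exact (R.tensorOperad_comp_isHom_right h₂ _ _ j).comp
        (R.tensorOperad_comp_isHom_right rfl _ _ l)
    · simp only [tensorOperad_comp_cls]
      refine cls_eq_of_eval_eq fun A φ v => ?_
      simp only [Word.eval_comp]
      congr 1
      funext j
      congr 1
      funext l
      have key : ∀ i, ((c ((blocks h).symm i)).eval A φ fun q => v (blocks h₁ ⟨i, q⟩)) =
          (fun s : Slots n => (c s).eval A φ fun q => v (blocks h₂ ⟨s.1, blocks rfl ⟨s.2, q⟩⟩))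
            ((blocks h).symm i) := by
        intro i
        dsimp only
        congr 1
        funext q
        exact congrArg v (Fin.ext (finSigmaFinEquiv_assoc h p i q))
      refine (key _).trans ?_
      rw [Equiv.symm_apply_apply]
  act_comp := by
    intro k m n h σ h' x y
    refine (R.generates_cls d k).eq_of_isHom
      ((R.tensorOperad_comp_isHom_left h x y).comp (R.tensorOperad_act_isHom σ))
      ((R.tensorOperad_act_isHom _).comp (R.tensorOperad_comp_isHom_left h' x _)) (fun a => ?_) x
    refine eq_of_generates (Y := (R.tensor m).obj d) (fun j => R.generates_cls d (n j))
      (f := fun y => (R.tensorOperad d).comp h ((R.tensorOperad d).act (R.cls a) σ) y)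
      (g := fun y => (R.tensorOperad d).act ((R.tensorOperad d).comp h' (R.cls a)
        fun j => y (σ.symm j)) (blockPerm σ h h'))
      (fun y j => R.tensorOperad_comp_isHom_right h _ y j) (fun y j => ?_) (fun b => ?_) y
    · obtain ⟨j, rfl⟩ := σ.symm.surjective j
      simp only [Function.update_comp_eq_of_injective' y σ.symm.injective]
      exact (R.tensorOperad_act_isHom _).comp (R.tensorOperad_comp_isHom_right h' _ _ j)
    · dsimp only
      rw [tensorOperad_act_cls, tensorOperad_comp_cls, tensorOperad_comp_cls, tensorOperad_act_cls]
      refine cls_eq_of_eval_eq fun A φ v => ?_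
      rw [Word.eval_comp, Word.eval_act, Word.eval_act, Word.eval_comp]
      congr 1
      funext j
      simp only [Function.comp_apply, blockPerm_symm_blocks]
  comp_act := by
    intro k m n h x y τ
    refine (R.generates_cls d k).eq_of_isHom
      (R.tensorOperad_comp_isHom_left h x _)
      ((R.tensorOperad_act_isHom _).comp (R.tensorOperad_comp_isHom_left h x _)) (fun a => ?_) x
    refine eq_of_generates (Y := (R.tensor m).obj d) (fun j => R.generates_cls d (n j))
      (f := fun y => (R.tensorOperad d).comp h (R.cls a)
        fun j => (R.tensorOperad d).act (y j) (τ j))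
      (g := fun y => (R.tensorOperad d).act ((R.tensorOperad d).comp h (R.cls a) y) _)
      (fun y j => ?_) (fun y j => ?_) (fun b => ?_) y
    · simp only [Function.apply_update fun j t => (R.tensorOperad d).act t (τ j)]
      exact (R.tensorOperad_comp_isHom_right h _ _ j).comp (R.tensorOperad_act_isHom (τ j))
    · exact (R.tensorOperad_act_isHom _).comp (R.tensorOperad_comp_isHom_right h _ y j)
    · simp only [tensorOperad_act_cls, tensorOperad_comp_cls]
      refine cls_eq_of_eval_eq fun A φ v => ?_
      rw [Word.eval_comp, Word.eval_act, Word.eval_comp]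
      congr 1
      funext j
      rw [Word.eval_act]
      congr 1
      funext i
      simp only [Function.comp_apply, permCongr_symm_blocks]

end OperadAlgebra

/-! ### Words and points -/

namespace OperadData

variable {P : ℕ → Type u} {C : OperadData P} {X : Type u}

variable (C) in
/-- The operation obtained from a word by inserting `pt` into the last inputs. -/
def Word.cap (pt : P 0) {n : ℕ} (w : Word P X n) : P n := C.cap pt n w.op

/-- Inserting `pt` into the last inputs is evaluation at the constant assignment with the value
given by `pt`. -/
theorem Word.act_cap (A : C.SetAlgebra) (pt : P 0) {n : ℕ} (w : Word P X n)
    (v : Fin n → A.carrier) :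
    A.act (w.cap C pt) v = w.eval A (fun _ => A.act pt Fin.elim0) v :=
  A.act_cap pt n w.op v

namespace IsOperad

theorem cap_one (hC : C.IsOperad) (pt : P 0) : (Word.one X C).cap C pt = C.one :=
  hC.eq_of_act_eq fun A v => by rw [Word.act_cap, Word.eval_one, A.one_act]

theorem cap_act (hC : C.IsOperad) (pt : P 0) {n : ℕ} (w : Word P X n) (σ : Perm (Fin n)) :
    (w.act C σ).cap C pt = C.act (w.cap C pt) σ :=
  hC.eq_of_act_eq fun A v => by
    rw [Word.act_cap, Word.eval_act, A.act_act, Word.act_cap]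

theorem cap_comp (hC : C.IsOperad) (pt : P 0) {k m : ℕ} {n : Fin k → ℕ} (h : ∑ j, n j = m)
    (a : Word P X k) (b : ∀ j, Word P X (n j)) :
    (Word.comp C h a b).cap C pt = C.comp h (a.cap C pt) fun j => (b j).cap C pt :=
  hC.eq_of_act_eq fun A v => by
    rw [Word.act_cap, Word.eval_comp, A.comp_act, Word.act_cap]
    simp only [Word.act_cap]

end IsOperad

/-- Two homomorphisms which are jointly injective detect the axioms of an operad. -/
theorem IsOperad.of_jointly_injective {P P₁ P₂ : ℕ → Type u} {C : OperadData P}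
    {C₁ : OperadData P₁} {C₂ : OperadData P₂} (hC₁ : C₁.IsOperad) (hC₂ : C₂.IsOperad)
    (f : ∀ {n}, P n → P₁ n) (g : ∀ {n}, P n → P₂ n)
    (hfg : ∀ {n} {x y : P n}, f x = f y → g x = g y → x = y)
    (f_one : f C.one = C₁.one) (g_one : g C.one = C₂.one)
    (f_act : ∀ {n} (x : P n) (σ : Perm (Fin n)), f (C.act x σ) = C₁.act (f x) σ)
    (g_act : ∀ {n} (x : P n) (σ : Perm (Fin n)), g (C.act x σ) = C₂.act (g x) σ)
    (f_comp : ∀ {k m : ℕ} {n : Fin k → ℕ} (h : ∑ j, n j = m) (x : P k) (y : ∀ j, P (n j)),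
      f (C.comp h x y) = C₁.comp h (f x) fun j => f (y j))
    (g_comp : ∀ {k m : ℕ} {n : Fin k → ℕ} (h : ∑ j, n j = m) (x : P k) (y : ∀ j, P (n j)),
      g (C.comp h x y) = C₂.comp h (g x) fun j => g (y j)) : C.IsOperad where
  act_one x := hfg (by rw [f_act, hC₁.act_one]) (by rw [g_act, hC₂.act_one])
  act_mul x σ τ := hfg (by simp only [f_act, hC₁.act_mul]) (by simp only [g_act, hC₂.act_mul])
  one_comp h x := hfg (by rw [f_comp, f_one, hC₁.one_comp]) (by rw [g_comp, g_one, hC₂.one_comp])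
  comp_one h x := hfg (by simp only [f_comp, f_one, hC₁.comp_one])
    (by simp only [g_comp, g_one, hC₂.comp_one])
  assoc h h₁ h₂ x y z := hfg
    (by simp only [f_comp]; exact hC₁.assoc h h₁ h₂ _ _ fun j l => f (z j l))
    (by simp only [g_comp]; exact hC₂.assoc h h₁ h₂ _ _ fun j l => g (z j l))
  act_comp h σ h' x y := hfg
    (by simp only [f_comp, f_act]; exact hC₁.act_comp h σ h' _ fun j => f (y j))
    (by simp only [g_comp, g_act]; exact hC₂.act_comp h σ h' _ fun j => g (y j))
  comp_act h x y τ := hfg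
    (by simp only [f_comp, f_act]; exact hC₁.comp_act h _ _ τ)
    (by simp only [g_comp, g_act]; exact hC₂.comp_act h _ _ τ)

end OperadData

theorem SimplicialOperad.map_compSplit (C : SimplicialOperad.{u}) {d d' : SimplexCategoryᵒᵖ}
    (φ : d ⟶ d') {k l m : ℕ} {n p : Fin k → ℕ} (h : ∑ j, n j = m) (y : (C.obj (k + l)).obj d)
    (z : ∀ j, (C.obj (n j + p j)).obj d) :
    (C.obj _).map φ ((C.data d).compSplit h y z) =
      (C.data d').compSplit h ((C.obj _).map φ y) (fun j => (C.obj _).map φ (z j)) := by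
  rw [OperadData.compSplit, C.map_compAt, OperadData.compSplit]
  congr 1
  funext j
  rcases j with j | j
  · rfl
  · exact C.map_one φ

theorem SimplicialOperad.map_cap (C : SimplicialOperad.{u}) {d d' : SimplexCategoryᵒᵖ}
    (φ : d ⟶ d') (pt : (C.obj 0).obj d) (n : ℕ) {l : ℕ} (y : (C.obj (n + l)).obj d) :
    (C.obj n).map φ ((C.data d).cap pt n y) =
      (C.data d').cap ((C.obj 0).map φ pt) n ((C.obj _).map φ y) := by
  rw [OperadData.cap, C.map_compAt, OperadData.cap]
  congr 1
  funext j
  rcases j with j | j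
  · exact C.map_one φ
  · rfl

/-! ### Functoriality of words -/

namespace OperadAlgebra

open OperadData

variable {C : SimplicialOperad.{u}} {B : Type (u + 1)} [Category.{u} B] {FB : B → B → Type u}
  {CB : B → Type u} [∀ X Y, FunLike (FB X Y) (CB X) (CB Y)] [ConcreteCategory B FB]
  [TensorBase B] {R R' : OperadAlgebra C B}

/-- The word `φ y ⊗ f r`. -/
def mapWord {d d' : SimplexCategoryᵒᵖ} (φ : d ⟶ d') (f : R.obj.obj d ⟶ R'.obj.obj d') {n : ℕ}
    (w : R.Words d n) : R'.Words d' n :=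
  ⟨w.len, (C.obj _).map φ w.op, fun i => f (w.arg i)⟩

section

variable {d d' : SimplexCategoryᵒᵖ} (φ : d ⟶ d') (f : R.obj.obj d ⟶ R'.obj.obj d')

theorem mapWord_one : mapWord φ f (Word.one _ (C.data d)) = Word.one _ (C.data d') := by
  unfold mapWord Word.one
  congr 1
  · exact C.map_one φ
  · exact funext fun i => Fin.elim0 i

theorem mapWord_act {n : ℕ} (w : R.Words d n) (σ : Perm (Fin n)) :
    mapWord φ f (w.act (C.data d) σ) = (mapWord φ f w).act (C.data d') σ := by
  unfold mapWord Word.act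
  congr 1
  exact C.map_act φ _ _

theorem mapWord_comp {k m : ℕ} {n : Fin k → ℕ} (h : ∑ j, n j = m) (a : R.Words d k)
    (b : ∀ j, R.Words d (n j)) :
    mapWord φ f (Word.comp (C.data d) h a b) =
      Word.comp (C.data d') h (mapWord φ f a) fun j => mapWord φ f (b j) := by
  unfold mapWord Word.comp
  congr 1
  · exact C.map_compSplit φ h a.op fun j => (b j).op
  · exact Word.comp_append_concat f a.arg fun j => (b j).arg

end

theorem tensor_map_cls {d d' : SimplexCategoryᵒᵖ} (φ : d ⟶ d') {n : ℕ} (w : R.Words d n) :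
    (R.tensor n).map φ (R.cls w) = R.cls (mapWord φ (R.obj.map φ) w) :=
  tensorMap_word n φ (R.obj.map φ) (R.map_act φ) w.op w.arg

theorem Hom.tensor_app_cls (f : Hom R R') {d : SimplexCategoryᵒᵖ} {n : ℕ} (w : R.Words d n) :
    (f.tensor n).app d (R.cls w) = R'.cls (mapWord (𝟙 d) (f.app.app d) w) :=
  tensorMap_word n (𝟙 d) (f.app.app d) f.map_act_id w.op w.arg

section

-- The morphisms `L n` are the maps `D_n ⊗_C R ⟶ D_n ⊗_C R'` induced by `φ` and `f`; this covers the
-- simplicial operators as well as the maps induced by morphisms of algebras.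
variable {d d' : SimplexCategoryᵒᵖ} {φ : d ⟶ d'} {f : R.obj.obj d ⟶ R'.obj.obj d'}
  {L : ∀ n, (R.tensor n).obj d ⟶ (R'.tensor n).obj d'}
  [TensorBase.Concrete B]

theorem apply_tensorOperad_one
    (hL : ∀ (n : ℕ) (w : R.Words d n), L n (R.cls w) = R'.cls (mapWord φ f w)) :
    L 1 (R.tensorOperad d).one = (R'.tensorOperad d').one :=
  (hL 1 _).trans (congrArg _ (mapWord_one φ f))

theorem apply_tensorOperad_act
    (hL : ∀ (n : ℕ) (w : R.Words d n), L n (R.cls w) = R'.cls (mapWord φ f w))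
    {n : ℕ} (t : ToType ((R.tensor n).obj d)) (σ : Perm (Fin n)) :
    L n ((R.tensorOperad d).act t σ) = (R'.tensorOperad d').act (L n t) σ := by
  refine (R.generates_cls d n).eq_of_isHom ((isHom_apply (L n)).comp (R.tensorOperad_act_isHom σ))
    ((R'.tensorOperad_act_isHom σ).comp (isHom_apply (L n))) (fun w => ?_) t
  rw [tensorOperad_act_cls, hL, hL, tensorOperad_act_cls, mapWord_act]

theorem apply_tensorOperad_comp
    (hL : ∀ (n : ℕ) (w : R.Words d n), L n (R.cls w) = R'.cls (mapWord φ f w))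
    {k m : ℕ} {n : Fin k → ℕ} (h : ∑ j, n j = m)
    (t : ToType ((R.tensor k).obj d)) (s : ∀ j, ToType ((R.tensor (n j)).obj d)) :
    L m ((R.tensorOperad d).comp h t s) =
      (R'.tensorOperad d').comp h (L k t) fun j => L (n j) (s j) := by
  refine (R.generates_cls d k).eq_of_isHom
    ((isHom_apply (L m)).comp (R.tensorOperad_comp_isHom_left h t s))
    ((R'.tensorOperad_comp_isHom_left h (L k t) _).comp (isHom_apply (L k))) (fun a => ?_) t
  refine eq_of_generates (Y := (R'.tensor m).obj d') (fun j => R.generates_cls d (n j))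
    (f := fun s => L m ((R.tensorOperad d).comp h (R.cls a) s))
    (g := fun s => (R'.tensorOperad d').comp h (L k (R.cls a)) fun j => L (n j) (s j))
    (fun s j => ?_) (fun s j => ?_) (fun b => ?_) s
  · exact (isHom_apply (L m)).comp (R.tensorOperad_comp_isHom_right h _ s j)
  · simp only [Function.apply_update fun j t => L (n j) t]
    exact (R'.tensorOperad_comp_isHom_right h _ _ j).comp (isHom_apply (L (n j)))
  · simp only [tensorOperad_comp_cls, hL, mapWord_comp]

end

variable (R)

/-! ### Fibres -/

variable {R} [∀ d, Unique ((C.obj 0).obj d)] {d d' : SimplexCategoryᵒᵖ} {n : ℕ}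

/-- The operation `γ(y; 1, …, 1, *, …, *)` over which the class of the word `y ⊗ r` lies. -/
abbrev base (w : R.Words d n) : (C.obj n).obj d := w.cap (C.data d) default

theorem base_mapWord (φ : d ⟶ d') (f : R.obj.obj d ⟶ R'.obj.obj d') (w : R.Words d n) :
    base (mapWord φ f w) = (C.obj n).map φ (base w) := by
  refine Eq.trans ?_ (C.map_cap φ default n w.op).symm
  rw [Subsingleton.elim ((C.obj 0).map φ default) default]
  rfl

theorem base_one : base (R := R) (Word.one _ (C.data d)) = (C.data d).one :=
  (C.isOperad d).cap_one default

theorem base_act (w : R.Words d n) (σ : Perm (Fin n)) :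
    base (w.act (C.data d) σ) = (C.data d).act (base w) σ :=
  (C.isOperad d).cap_act default w σ

theorem base_comp {k m : ℕ} {n : Fin k → ℕ} (h : ∑ j, n j = m) (a : R.Words d k)
    (b : ∀ j, R.Words d (n j)) : base (Word.comp (C.data d) h a b) =
      (C.data d).comp h (base a) fun j => base (b j) :=
  (C.isOperad d).cap_comp default h a b

/-- The grading by `base` is compatible with reductions because `C(0)` is a point. -/
theorem Reduces.base_eq {w w' : R.Words d n} (h : Reduces w w') : base w = base w' := by
  obtain ⟨m, z, t, h, -⟩ := h
  refine (C.isOperad d).eq_of_act_eq fun A v => ?_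
  rw [Word.act_cap, h, Word.act_cap]
  unfold Word.eval
  congr 2
  funext j
  -- Inserting points into all inputs of `z j` gives the point.
  have hz : (C.data d).comp (n := fun _ : Fin (m j) => 0) (by simp) (z j) (fun _ => default) =
      (default : (C.obj 0).obj d) := Subsingleton.elim _ _
  conv_rhs => rw [Function.comp_apply, ← hz, A.comp_act]
  congr 1

/-- The objects `E x` with the morphisms `i x` are the fibres of `D_n ⊗_C R` over `C(n)`, on the
simplicial level `d`. -/
structure IsFibreFamily {E : (C.obj n).obj d → B} (i : ∀ x, E x ⟶ (R.tensor n).obj d) : Prop where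
  coproduct : Nonempty (IsColimit (Cofan.mk ((R.tensor n).obj d) i))
  exists_apply_eq_cls : ∀ w : R.Words d n, ∃ e, i (base w) e = R.cls w

theorem IsFibreFamily.exists_of_base_eq {E : (C.obj n).obj d → B}
    {i : ∀ x, E x ⟶ (R.tensor n).obj d} (hi : IsFibreFamily i) {w : R.Words d n}
    {x : (C.obj n).obj d} (h : base w = x) : ∃ e, i x e = R.cls w := by
  subst h
  exact hi.exists_apply_eq_cls w

variable [TensorBase.Concrete B]

namespace IsFibreFamily

variable {E : (C.obj n).obj d → B} {i : ∀ x, E x ⟶ (R.tensor n).obj d}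

theorem injective (hi : IsFibreFamily i) (x : (C.obj n).obj d) : Function.Injective (i x) :=
  ‹TensorBase.Concrete B›.inj_injective i hi.coproduct.some x

/-- A fibre is generated by its elements which are classes of words: the other words have no
component in it. -/
theorem generates (hi : IsFibreFamily i) (x : (C.obj n).obj d) :
    Generates fun e : {e // ∃ w : R.Words d n, base w = x ∧ i x e = R.cls w} => e.1 :=
  ‹TensorBase.Concrete B›.fibre_generates i hi.coproduct.some _ (R.generates_cls d n) base
    hi.exists_apply_eq_cls x

/-- A morphism to `D_n ⊗_C R` which maps the generators of a fibre to classes of words over `x`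
factors through the fibre over `x`. -/
theorem exists_lift (hi : IsFibreFamily i) {X : B} {W : Type u} {v : W → ToType X}
    (hv : Generates v) (L : X ⟶ (R.tensor n).obj d) (x : (C.obj n).obj d)
    (h : ∀ a, ∃ w : R.Words d n, base w = x ∧ L (v a) = R.cls w) :
    ∃ L' : X ⟶ E x, ∀ t, i x (L' t) = L t :=
  ‹TensorBase.Concrete B›.exists_lift v hv L (i x) (hi.injective x) fun a => by
    obtain ⟨w, hw, ha⟩ := h a
    rw [ha]
    exact hi.exists_of_base_eq hw

end IsFibreFamily

variable (R) in
/-- The morphism from `D_n ⊗_C R` to a coproduct of copies of itself which puts the class of a word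
`w` into the summand `base w` is well defined, so that `base` splits `D_n ⊗_C R` into fibres. -/
theorem exists_isFibreFamily (n : ℕ) (d : SimplexCategoryᵒᵖ) :
    ∃ (E : (C.obj n).obj d → B) (i : ∀ x, E x ⟶ (R.tensor n).obj d), IsFibreFamily i := by
  obtain ⟨δ, hδ⟩ := R.exists_desc (d := d) (n := n)
    (Y := TensorBase.powers (fun _ : (C.obj n).obj d => 1) ((R.tensor n).obj d))
    (fun w => TensorBase.word (fun _ : (C.obj n).obj d => 1) ((R.tensor n).obj d) (base w)
      fun _ => R.cls w)
    (fun y => isMulti_iff_isHom.2 fun r i =>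
      (isHom_of_isMulti_single (TensorBase.word_isMulti (fun _ : (C.obj n).obj d => 1)
        ((R.tensor n).obj d) ((C.data d).cap default n y)) (R.cls ⟨_, y, r⟩)).comp
        (R.cls_isHom y r i))
    fun h => by rw [h.base_eq, h.cls_eq]
  obtain ⟨E, i, hc, hi⟩ :=
    ‹TensorBase.Concrete B›.exists_fibres R.cls (R.generates_cls d n) base δ hδ
  exact ⟨E, i, hc, hi⟩

variable (R)

/-- The fibre of `D_n ⊗_C R` over `x`. -/
noncomputable def fibre (n : ℕ) (d : SimplexCategoryᵒᵖ) (x : (C.obj n).obj d) : B :=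
  (R.exists_isFibreFamily n d).choose x

/-- The inclusion of the fibre over `x`. -/
noncomputable def fibreι (n : ℕ) (d : SimplexCategoryᵒᵖ) (x : (C.obj n).obj d) :
    R.fibre n d x ⟶ (R.tensor n).obj d :=
  (R.exists_isFibreFamily n d).choose_spec.choose x

theorem isFibreFamily_fibreι (n : ℕ) (d : SimplexCategoryᵒᵖ) :
    IsFibreFamily (R.fibreι n d) :=
  (R.exists_isFibreFamily n d).choose_spec.choose_spec

end OperadAlgebra

/-! ### The operad of the fibres -/

namespace OperadAlgebra

open OperadData

variable {C : SimplicialOperad.{u}} {B : Type (u + 1)} [Category.{u} B] {FB : B → B → Type u}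
  {CB : B → Type u} [∀ X Y, FunLike (FB X Y) (CB X) (CB Y)] [ConcreteCategory B FB]
  [TensorBase B] [∀ d, Unique ((C.obj 0).obj d)] [TensorBase.Concrete B] (R : OperadAlgebra C B)

/-- The simplicial operator `φ` maps the fibre over `x` to the fibre over `φ x`. -/
theorem exists_fibreMap {n : ℕ} {p q : (C.obj n).Elements} (φ : p ⟶ q) :
    ∃ L : R.fibre n p.1 p.2 ⟶ R.fibre n q.1 q.2,
      ∀ e, R.fibreι n q.1 q.2 (L e) = (R.tensor n).map φ.1 (R.fibreι n p.1 p.2 e) := by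
  obtain ⟨L, hL⟩ := (R.isFibreFamily_fibreι n q.1).exists_lift
    ((R.isFibreFamily_fibreι n p.1).generates p.2)
    (R.fibreι n p.1 p.2 ≫ (R.tensor n).map φ.1) q.2 (by
      rintro ⟨e, w, hw, he⟩
      refine ⟨mapWord φ.1 (R.obj.map φ.1) w, ?_, ?_⟩
      · rw [base_mapWord, hw]
        exact φ.2
      · rw [ConcreteCategory.comp_apply, he, tensor_map_cls])
  exact ⟨L, fun e => by rw [hL, ConcreteCategory.comp_apply]⟩

/-- The fibres of `D_n ⊗_C R` as a functor on the category of elements of `C(n)`. -/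
noncomputable def fibreFunctor (n : ℕ) : (C.obj n).Elements ⥤ B where
  obj p := R.fibre n p.1 p.2
  map φ := (R.exists_fibreMap φ).choose
  map_id p := ConcreteCategory.hom_ext _ _ fun e =>
    (R.isFibreFamily_fibreι n p.1).injective p.2 (by
      rw [(R.exists_fibreMap _).choose_spec]
      simp)
  map_comp φ ψ := ConcreteCategory.hom_ext _ _ fun e =>
    (R.isFibreFamily_fibreι n _).injective _ (by
      rw [(R.exists_fibreMap _).choose_spec, ConcreteCategory.comp_apply,
        (R.exists_fibreMap _).choose_spec, (R.exists_fibreMap _).choose_spec]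
      simp)

/-- The comparison of the fibres with `D_n ⊗_C R`. -/
noncomputable def fibreFunctorι (n : ℕ) :
    R.fibreFunctor n ⟶ CategoryOfElements.π (C.obj n) ⋙ R.tensor n where
  app p := R.fibreι n p.1 p.2
  naturality _ _ φ := ConcreteCategory.hom_ext _ _ fun e =>
    (ConcreteCategory.comp_apply _ _ _).trans
      (((R.exists_fibreMap φ).choose_spec e).trans (ConcreteCategory.comp_apply _ _ _).symm)

variable {d : SimplexCategoryᵒᵖ}

theorem exists_fibre_one : ∃ e, R.fibreι 1 d (C.data d).one e = (R.tensorOperad d).one :=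
  (R.isFibreFamily_fibreι 1 d).exists_of_base_eq base_one

theorem exists_fibre_act {n : ℕ} (x : (C.obj n).obj d) (σ : Perm (Fin n)) :
    ∃ L : R.fibre n d x ⟶ R.fibre n d ((C.data d).act x σ),
      ∀ e, R.fibreι n d _ (L e) = (R.tensorOperad d).act (R.fibreι n d x e) σ := by
  obtain ⟨M, hM⟩ := R.tensorOperad_act_isHom (d := d) σ
  obtain ⟨L, hL⟩ := (R.isFibreFamily_fibreι n d).exists_lift
    ((R.isFibreFamily_fibreι n d).generates x) (R.fibreι n d x ≫ M) ((C.data d).act x σ) (by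
      rintro ⟨e, w, hw, he⟩
      refine ⟨w.act (C.data d) σ, ?_, ?_⟩
      · rw [base_act, hw]
      · rw [ConcreteCategory.comp_apply, he, hM]
        exact R.tensorOperad_act_cls w σ)
  exact ⟨L, fun e => by rw [hL, ConcreteCategory.comp_apply, hM]⟩

section

variable {k m : ℕ} {n : Fin k → ℕ} (h : ∑ j, n j = m) (x : (C.obj k).obj d)
  (y : ∀ j, (C.obj (n j)).obj d)

theorem comp_fibreι_isHom_left (t : ToType (R.fibre k d x))
    (s : ∀ j, ToType (R.fibre (n j) d (y j))) :
    IsHom (X := R.fibre k d x) (Y := (R.tensor m).obj d) fun t =>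
      (R.tensorOperad d).comp h (R.fibreι k d x t) fun j => R.fibreι (n j) d (y j) (s j) :=
  (R.tensorOperad_comp_isHom_left h (R.fibreι k d x t) _).comp (isHom_apply _)

theorem comp_fibreι_isHom_right (t : ToType ((R.tensor k).obj d))
    (s : ∀ j, ToType (R.fibre (n j) d (y j))) (j : Fin k) :
    IsHom (X := R.fibre (n j) d (y j)) (Y := (R.tensor m).obj d) fun e =>
      (R.tensorOperad d).comp h t fun j' =>
        R.fibreι (n j') d (y j') (Function.update s j e j') := by
  simp only [Function.apply_update fun j t => R.fibreι (n j) d (y j) t]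
  exact (R.tensorOperad_comp_isHom_right h _ _ j).comp (isHom_apply _)

/-- The composition of classes of words over `x` and over the `y j` lies over `γ(x; y)`, and the
fibres are generated by such classes, so that the composition maps fibres to fibres. -/
theorem exists_fibre_comp (t : ToType (R.fibre k d x))
    (s : ∀ j, ToType (R.fibre (n j) d (y j))) :
    ∃ e, R.fibreι m d ((C.data d).comp h x y) e =
      (R.tensorOperad d).comp h (R.fibreι k d x t) fun j => R.fibreι (n j) d (y j) (s j) := by
  obtain ⟨M, hM⟩ := R.comp_fibreι_isHom_left h x y t s
  obtain ⟨L, hL⟩ := ‹TensorBase.Concrete B›.exists_lift _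
    ((R.isFibreFamily_fibreι k d).generates x) M (R.fibreι m d ((C.data d).comp h x y))
    ((R.isFibreFamily_fibreι m d).injective _) (by
      rintro ⟨e, w, hw, he⟩
      rw [hM]
      refine exists_of_generates (fun j => (R.isFibreFamily_fibreι (n j) d).generates (y j)) _
        ((R.isFibreFamily_fibreι m d).injective _)
        (f := fun s => (R.tensorOperad d).comp h (R.fibreι k d x e) fun j =>
          R.fibreι (n j) d (y j) (s j)) (R.comp_fibreι_isHom_right h y _) (fun v => ?_) s
      choose b hb hb' using fun j => (v j).2
      simp only [he, hb', tensorOperad_comp_cls]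
      refine (R.isFibreFamily_fibreι m d).exists_of_base_eq ?_
      rw [base_comp, hw]
      simp only [hb])
  exact ⟨L t, by rw [hL, hM]⟩

end

/-- The operations on the fibres of `D_n ⊗_C R`. -/
noncomputable def fibredData : FiberedOperadData C B where
  obj := R.fibreFunctor
  one d := (R.exists_fibre_one (d := d)).choose
  act x σ := (R.exists_fibre_act x σ).choose
  comp h x y t s := (R.exists_fibre_comp h x y t s).choose
  comp_isMulti {d k m n} h x y := by
    have hm := fun t s => (R.exists_fibre_comp h x y t s).choose_spec
    refine (isMulti_elim_iff (X := R.fibre k d x) (Y := fun j => R.fibre (n j) d (y j))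
      (Z := R.fibre m d ((C.data d).comp h x y))
      (f := fun t s => (R.exists_fibre_comp h x y t s).choose)).2 ⟨fun t s => ?_, fun t s j => ?_⟩
    · obtain ⟨L, hL⟩ := R.comp_fibreι_isHom_left h x y t s
      exact .of_comp ((R.isFibreFamily_fibreι m d).injective _)
        ⟨L, fun e => (hL e).trans (hm _ _).symm⟩
    · obtain ⟨L, hL⟩ := R.comp_fibreι_isHom_right h y (R.fibreι k d x t) s j
      exact .of_comp ((R.isFibreFamily_fibreι m d).injective _)
        ⟨L, fun e => (hL e).trans (hm _ _).symm⟩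

/-- The image in `D_n ⊗_C R` of an element of a fibre. -/
noncomputable def totalι {n : ℕ} (q : R.fibredData.Total d n) : ToType ((R.tensor n).obj d) :=
  R.fibreι n d q.1 q.2

/-- An element of a fibre is determined by its base point and its class in `D_n ⊗_C R`; hence the
operad axioms can be checked separately in `C` and in `D_n ⊗_C R`. -/
theorem total_ext {n : ℕ} {q q' : R.fibredData.Total d n} (h : q.1 = q'.1)
    (h' : R.totalι q = R.totalι q') : q = q' := by
  obtain ⟨x, e⟩ := q
  obtain ⟨x', e'⟩ := q'
  obtain rfl : x = x' := h
  exact congrArg _ ((R.isFibreFamily_fibreι n d).injective x h')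

theorem totalι_one : R.totalι (R.fibredData.total d).one = (R.tensorOperad d).one :=
  (R.exists_fibre_one (d := d)).choose_spec

theorem totalι_act {n : ℕ} (q : R.fibredData.Total d n) (σ : Perm (Fin n)) :
    R.totalι ((R.fibredData.total d).act q σ) = (R.tensorOperad d).act (R.totalι q) σ :=
  (R.exists_fibre_act q.1 σ).choose_spec q.2

theorem totalι_comp {k m : ℕ} {n : Fin k → ℕ} (h : ∑ j, n j = m) (q : R.fibredData.Total d k)
    (q' : ∀ j, R.fibredData.Total d (n j)) :
    R.totalι ((R.fibredData.total d).comp h q q') =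
      (R.tensorOperad d).comp h (R.totalι q) fun j => R.totalι (q' j) :=
  (R.exists_fibre_comp h q.1 (fun j => (q' j).1) q.2 fun j => (q' j).2).choose_spec

theorem totalι_map {d' : SimplexCategoryᵒᵖ} (φ : d ⟶ d') {n : ℕ} (q : R.fibredData.Total d n) :
    R.totalι (R.fibredData.totalMap φ n q) = (R.tensor n).map φ (R.totalι q) :=
  (R.exists_fibreMap (CategoryOfElements.homMk (F := C.obj n) ⟨d, q.1⟩
    ⟨d', (C.obj n).map φ q.1⟩ φ rfl)).choose_spec q.2

/-- The operad fibered over `C` formed by the fibres of the objects `D_n ⊗_C R`. -/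
noncomputable def fibredOperad : FiberedOperad C B where
  toFiberedOperadData := R.fibredData
  isOperad d := (C.isOperad d).of_jointly_injective (R.tensorOperad_isOperad d) Sigma.fst R.totalι
    R.total_ext rfl R.totalι_one (fun _ _ => rfl) R.totalι_act (fun _ _ _ => rfl) R.totalι_comp
  map_one φ := R.total_ext (C.map_one φ) (by
    rw [totalι_map, totalι_one, totalι_one,
      apply_tensorOperad_one (L := fun n => (R.tensor n).map φ) fun _ => tensor_map_cls φ])
  map_act φ _ q σ := R.total_ext (C.map_act φ _ _) (by
    rw [totalι_map, totalι_act, totalι_act, totalι_map,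
      apply_tensorOperad_act (L := fun n => (R.tensor n).map φ) fun _ => tensor_map_cls φ])
  map_comp φ _ _ _ h q q' := R.total_ext (C.map_comp φ h _ _) (by
    rw [totalι_map, totalι_comp, totalι_comp, totalι_map,
      apply_tensorOperad_comp (L := fun n => (R.tensor n).map φ) fun _ => tensor_map_cls φ]
    simp only [totalι_map])

theorem isCanonicalStructure_fibredOperad :
    IsCanonicalStructure R R.fibredOperad R.fibreFunctorι where
  coproduct n d := (R.isFibreFamily_fibreι n d).coproduct
  fibre y r := (R.isFibreFamily_fibreι _ _).exists_apply_eq_cls ⟨_, y, r⟩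
  one _ := R.totalι_one
  act x σ q l y r hq := (R.totalι_act ⟨x, q⟩ σ).trans
    ((congrArg (fun t => (R.tensorOperad _).act t σ) hq).trans
      (R.tensorOperad_act_cls ⟨l, y, r⟩ σ))
  comp {_ _ _ _} h x x' q q' l p y y' r r' hq hq' :=
    (R.totalι_comp h ⟨x, q⟩ fun j => ⟨x' j, q' j⟩).trans
      ((congrArg₂ (fun t s => (R.tensorOperad _).comp h t s) hq (funext hq')).trans
        (R.tensorOperad_comp_cls h ⟨l, y, r⟩ fun j => ⟨p j, y' j, r' j⟩))

end OperadAlgebra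

/-! ### Morphisms between canonical structures -/

namespace IsCanonicalStructure

open OperadAlgebra OperadData

variable {C : SimplicialOperad.{u}} {B : Type (u + 1)} [Category.{u} B] {FB : B → B → Type u}
  {CB : B → Type u} [∀ X Y, FunLike (FB X Y) (CB X) (CB Y)] [ConcreteCategory B FB]
  [TensorBase B] [∀ d, Unique ((C.obj 0).obj d)]
  {R R' : OperadAlgebra C B} {Q Q' : FiberedOperad C B}
  {α : ∀ n, Q.obj n ⟶ CategoryOfElements.π (C.obj n) ⋙ R.tensor n}
  {α' : ∀ n, Q'.obj n ⟶ CategoryOfElements.π (C.obj n) ⋙ R'.tensor n}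

theorem isFibreFamily (hQ : IsCanonicalStructure R Q α) (n : ℕ) (d : SimplexCategoryᵒᵖ) :
    IsFibreFamily (R := R) fun x : (C.obj n).obj d => (α n).app ⟨d, x⟩ where
  coproduct := hQ.coproduct n d
  exists_apply_eq_cls w := hQ.fibre w.op w.arg

variable [TensorBase.Concrete B] {d : SimplexCategoryᵒᵖ}

theorem injective (hQ : IsCanonicalStructure R Q α) (n : ℕ) (p : (C.obj n).Elements) :
    Function.Injective ((α n).app p) :=
  (hQ.isFibreFamily n p.1).injective p.2

theorem app_one (hQ : IsCanonicalStructure R Q α) :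
    (α 1).app ⟨d, (C.data d).one⟩ (Q.one d) = (R.tensorOperad d).one :=
  hQ.one d

/-- The action on `Q` is given by the action on `D_n ⊗_C R`: the description on classes of words
suffices, since the fibres of `Q` are generated by elements mapped to such classes. -/
theorem app_act (hQ : IsCanonicalStructure R Q α) {n : ℕ} (x : (C.obj n).obj d)
    (σ : Perm (Fin n)) (q : ToType ((Q.obj n).obj ⟨d, x⟩)) :
    (α n).app ⟨d, (C.data d).act x σ⟩ (Q.act x σ q) =
      (R.tensorOperad d).act ((α n).app ⟨d, x⟩ q) σ := by
  refine ((hQ.isFibreFamily n d).generates x).eq_of_isHom (Y := (R.tensor n).obj d)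
    ((isHom_apply ((α n).app ⟨d, (C.data d).act x σ⟩)).comp (isHom_apply (Q.act x σ)))
    ((R.tensorOperad_act_isHom σ).comp (isHom_apply ((α n).app ⟨d, x⟩))) ?_ q
  rintro ⟨e, w, -, he⟩
  exact (hQ.act x σ e w.op w.arg he).trans ((R.tensorOperad_act_cls w σ).symm.trans
    (congrArg (fun t => (R.tensorOperad d).act t σ) he.symm))

theorem app_comp (hQ : IsCanonicalStructure R Q α) {k m : ℕ} {n : Fin k → ℕ} (h : ∑ j, n j = m)
    (x : (C.obj k).obj d) (y : ∀ j, (C.obj (n j)).obj d)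
    (q : ToType ((Q.obj k).obj ⟨d, x⟩)) (q' : ∀ j, ToType ((Q.obj (n j)).obj ⟨d, y j⟩)) :
    (α m).app ⟨d, (C.data d).comp h x y⟩ (Q.comp h x y q q') =
      (R.tensorOperad d).comp h ((α k).app ⟨d, x⟩ q) fun j => (α (n j)).app ⟨d, y j⟩ (q' j) := by
  obtain ⟨hl, hr⟩ := (isMulti_elim_iff (X := (Q.obj k).obj ⟨d, x⟩)
    (Y := fun j => (Q.obj (n j)).obj ⟨d, y j⟩)).1 (Q.comp_isMulti h x y)
  refine ((hQ.isFibreFamily k d).generates x).eq_of_isHom (Y := (R.tensor m).obj d)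
    ((isHom_apply ((α m).app ⟨d, (C.data d).comp h x y⟩)).comp (hl q q'))
    ((R.tensorOperad_comp_isHom_left h ((α k).app ⟨d, x⟩ q) fun j =>
      (α (n j)).app ⟨d, y j⟩ (q' j)).comp (isHom_apply ((α k).app ⟨d, x⟩))) ?_ q
  rintro ⟨e, w, -, he⟩
  refine eq_of_generates (Y := (R.tensor m).obj d)
    (fun j => (hQ.isFibreFamily (n j) d).generates (y j))
    (f := fun q' => (α m).app ⟨d, (C.data d).comp h x y⟩ (Q.comp h x y e q'))
    (g := fun q' => (R.tensorOperad d).comp h ((α k).app ⟨d, x⟩ e)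
      fun j => (α (n j)).app ⟨d, y j⟩ (q' j))
    (fun s j => ?_) (fun s j => ?_) (fun v => ?_) q'
  · exact (isHom_apply ((α m).app ⟨d, (C.data d).comp h x y⟩)).comp (hr e s j)
  · simp only [Function.apply_update fun j t => (α (n j)).app ⟨d, y j⟩ t]
    exact (R.tensorOperad_comp_isHom_right h ((α k).app ⟨d, x⟩ e) _ j).comp
      (isHom_apply ((α (n j)).app ⟨d, y j⟩))
  · choose b hb hb' using fun j => (v j).2
    exact (hQ.comp h x y e _ w.op (fun j => (b j).op) w.arg (fun j => (b j).arg) he hb').trans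
      ((R.tensorOperad_comp_cls h w b).symm.trans
        (congrArg₂ (fun t s => (R.tensorOperad d).comp h t s) he.symm (funext hb').symm))

/-- The map `D_n ⊗_C f` preserves fibres because a morphism of algebras does not change the
operation in a word. -/
theorem exists_lift (hQ : IsCanonicalStructure R Q α) (hQ' : IsCanonicalStructure R' Q' α')
    (f : R.Hom R') (n : ℕ) (p : (C.obj n).Elements) :
    ∃ L : (Q.obj n).obj p ⟶ (Q'.obj n).obj p,
      ∀ q, (α' n).app p (L q) = (f.tensor n).app p.1 ((α n).app p q) := by
  obtain ⟨L, hL⟩ := (hQ'.isFibreFamily n p.1).exists_lift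
    ((hQ.isFibreFamily n p.1).generates p.2)
    ((α n).app p ≫ (f.tensor n).app p.1) p.2 (by
      rintro ⟨e, w, hw, he⟩
      refine ⟨mapWord (𝟙 _) (f.app.app p.1) w, ?_, ?_⟩
      · rw [base_mapWord, hw]
        simp
      · exact (ConcreteCategory.comp_apply _ _ _).trans
          ((congrArg _ he).trans (f.tensor_app_cls w)))
  exact ⟨L, fun q => (hL q).trans (ConcreteCategory.comp_apply _ _ _)⟩

/-- The natural transformation of fibres covering `D_n ⊗_C f`. -/
noncomputable def homApp (hQ : IsCanonicalStructure R Q α) (hQ' : IsCanonicalStructure R' Q' α')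
    (f : R.Hom R') (n : ℕ) : Q.obj n ⟶ Q'.obj n where
  app p := (hQ.exists_lift hQ' f n p).choose
  naturality p q φ := ConcreteCategory.hom_ext _ _ fun e => hQ'.injective n q (by
    have hα := fun e => ConcreteCategory.congr_hom ((α n).naturality φ) e
    have hα' := fun e => ConcreteCategory.congr_hom ((α' n).naturality φ) e
    have hf := fun e => ConcreteCategory.congr_hom ((f.tensor n).naturality φ.1) e
    simp only [ConcreteCategory.comp_apply] at hα hα' hf ⊢
    rw [(hQ.exists_lift hQ' f n q).choose_spec, hα, hα', (hQ.exists_lift hQ' f n p).choose_spec]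
    exact hf _)

theorem app_homApp (hQ : IsCanonicalStructure R Q α) (hQ' : IsCanonicalStructure R' Q' α')
    (f : R.Hom R') (n : ℕ) (p : (C.obj n).Elements) (q : ToType ((Q.obj n).obj p)) :
    (α' n).app p ((hQ.homApp hQ' f n).app p q) = (f.tensor n).app p.1 ((α n).app p q) :=
  (hQ.exists_lift hQ' f n p).choose_spec q

/-- The morphism of fibered operads covering the maps `D_n ⊗_C f`. -/
noncomputable def hom (hQ : IsCanonicalStructure R Q α) (hQ' : IsCanonicalStructure R' Q' α')
    (f : R.Hom R') : Q.Hom Q' where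
  app := hQ.homApp hQ' f
  map_one d := hQ'.injective 1 _ <|
    (hQ.app_homApp hQ' f 1 _ _).trans <| (congrArg ((f.tensor 1).app d) hQ.app_one).trans <|
      (apply_tensorOperad_one (L := fun n => (f.tensor n).app d) fun _ => f.tensor_app_cls).trans
        hQ'.app_one.symm
  map_act {d n} x σ q := hQ'.injective n _ <|
    (hQ.app_homApp hQ' f n _ _).trans <|
      (congrArg ((f.tensor n).app d) (hQ.app_act x σ q)).trans <|
      (apply_tensorOperad_act (L := fun n => (f.tensor n).app d) (fun _ => f.tensor_app_cls)
        _ σ).trans <|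
      (congrArg (fun t => (R'.tensorOperad d).act t σ)
        (hQ.app_homApp hQ' f n ⟨d, x⟩ q).symm).trans (hQ'.app_act x σ _).symm
  map_comp {d k m n} h x y q q' := hQ'.injective m _ <|
    (hQ.app_homApp hQ' f m _ _).trans <|
      (congrArg ((f.tensor m).app d) (hQ.app_comp h x y q q')).trans <|
      (apply_tensorOperad_comp (L := fun n => (f.tensor n).app d) (fun _ => f.tensor_app_cls)
        h _ _).trans <|
      (congrArg₂ (fun t s => (R'.tensorOperad d).comp h t s)
        (hQ.app_homApp hQ' f k ⟨d, x⟩ q).symm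
        (funext fun j => (hQ.app_homApp hQ' f (n j) ⟨d, y j⟩ (q' j)).symm)).trans
        (hQ'.app_comp h x y _ _).symm

theorem existsUnique_hom (hQ : IsCanonicalStructure R Q α) (hQ' : IsCanonicalStructure R' Q' α')
    (f : R.Hom R') : ∃! F : Q.Hom Q', ∀ n, F.app n ≫ α' n =
      α n ≫ Functor.whiskerLeft (CategoryOfElements.π (C.obj n)) (f.tensor n) := by
  refine ⟨hQ.hom hQ' f, fun n => ?_, fun F hF => FiberedOperad.Hom.ext (funext fun n => ?_)⟩
  · ext p : 2
    refine ConcreteCategory.hom_ext _ _ fun q => ?_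
    exact (ConcreteCategory.comp_apply _ _ _).trans
      ((hQ.app_homApp hQ' f n p q).trans (ConcreteCategory.comp_apply _ _ _).symm)
  · ext p : 2
    refine ConcreteCategory.hom_ext _ _ fun q => hQ'.injective n p ?_
    refine Eq.trans ?_ (hQ.app_homApp hQ' f n p q).symm
    have := ConcreteCategory.congr_hom (congrArg (fun η => η.app p) (hF n)) q
    exact (ConcreteCategory.comp_apply _ _ _).symm.trans
      (this.trans (ConcreteCategory.comp_apply _ _ _))

end IsCanonicalStructure

theorem mainTheorem7 :
    (∀ (C : SimplicialOperad.{u}) [∀ d, Unique ((C.obj 0).obj d)],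
      (∀ R : OperadAlgebra C (Type u), ∃ (Q : FiberedOperad C (Type u))
        (α : ∀ n, Q.obj n ⟶ CategoryOfElements.π (C.obj n) ⋙ R.tensor n),
        IsCanonicalStructure R Q α) ∧
      (∀ (R R' : OperadAlgebra C (Type u)) (f : R.Hom R') (Q Q' : FiberedOperad C (Type u))
        (α : ∀ n, Q.obj n ⟶ CategoryOfElements.π (C.obj n) ⋙ R.tensor n)
        (α' : ∀ n, Q'.obj n ⟶ CategoryOfElements.π (C.obj n) ⋙ R'.tensor n),
        IsCanonicalStructure R Q α → IsCanonicalStructure R' Q' α' →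
        ∃! F : Q.Hom Q', ∀ n, F.app n ≫ α' n =
          α n ≫ Functor.whiskerLeft (CategoryOfElements.π (C.obj n)) (f.tensor n))) ∧
    (∀ (K : Type u) [Field K] (C : SimplicialOperad.{u}) [∀ d, Unique ((C.obj 0).obj d)],
      (∀ R : OperadAlgebra C (ModuleCat.{u} K), ∃ (Q : FiberedOperad C (ModuleCat.{u} K))
        (α : ∀ n, Q.obj n ⟶ CategoryOfElements.π (C.obj n) ⋙ R.tensor n),
        IsCanonicalStructure R Q α) ∧
      (∀ (R R' : OperadAlgebra C (ModuleCat.{u} K)) (f : R.Hom R')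
        (Q Q' : FiberedOperad C (ModuleCat.{u} K))
        (α : ∀ n, Q.obj n ⟶ CategoryOfElements.π (C.obj n) ⋙ R.tensor n)
        (α' : ∀ n, Q'.obj n ⟶ CategoryOfElements.π (C.obj n) ⋙ R'.tensor n),
        IsCanonicalStructure R Q α → IsCanonicalStructure R' Q' α' →
        ∃! F : Q.Hom Q', ∀ n, F.app n ≫ α' n =
          α n ≫ Functor.whiskerLeft (CategoryOfElements.π (C.obj n)) (f.tensor n))) := by
  exact
    ⟨fun _ _ => ⟨fun R => ⟨R.fibredOperad, R.fibreFunctorι, R.isCanonicalStructure_fibredOperad⟩,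
      fun _ _ f _ _ _ _ hQ hQ' => hQ.existsUnique_hom hQ' f⟩,
    fun _ _ _ _ => ⟨fun R => ⟨R.fibredOperad, R.fibreFunctorι, R.isCanonicalStructure_fibredOperad⟩,
      fun _ _ f _ _ _ _ hQ hQ' => hQ.existsUnique_hom hQ' f⟩⟩
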